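/- For integers $q_1,\dots,q_n$ ($n\ge 1$) let $P(q_1,\dots,q_n)$ be the pretzel link, whose standard diagram consists of $n$ vertical twist regions placed side by side, the $i$-th one being a column of $|q_i|$ crossings (half-twists) whose handedness is given by the sign of $q_i$; the right-hand strand of each region is joined at the top and at the bottom to the left-hand strand of the next region, cyclically. It is a knot if and only if either exactly one $q_i$ is even, or $n$ and all $q_i$ are odd. Write $f\doteq g$ if $f=\pm t^k g$ for some $k\in\mathbb Z$, let $\sigma_k(q_1,\dots,q_n)$ be the elementary symmetric polynomial of degree $k$, and let $\Delta_K(t)\in\mathbb Z[t,t^{-1}]$ be the Alexander polynomial of $K$, i.e. the determinant of the Alexander matrix of an oriented diagram of $K$ after deleting one row and one column, which is well defined up to multiplication by $\pm t^k$. **Theorem.** Let $K=P(q_1,\dots,q_n)$ be a pretzel knot. (1) If $n$ is odd, $q_j$ is even and all $q_i$ with $i\ne j$ are odd, then $$\Delta_K(t)\doteq\left(\prod_{i\neq j}\frac{1+t^{q_i}}{1+t}\right)\left(1+\frac{q_j}{2}\,(t^{-1}-t)\left(\sum_{i\ne j}\frac{t^{q_i}}{1+t^{q_i}}-\frac{n-1}{2}\right)\right).$$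 (2) If $n$ is even, $q_j$ is even and all $q_i$ with $i\ne j$ are odd, then $$\Delta_K(t)\doteq\left(\prod_{i\neq j}\frac{1+t^{q_i}}{1+t}\right)\left(t^{q_j/2}+\left(t^{q_j/2}-t^{-q_j/2}\right)\left(\sum_{i\ne j}\frac{t^{q_i}}{1+t^{q_i}}-\frac{n}{2}\right)\right).$$ (3) If $n$ and all $q_i$ are odd, then $$\Delta_K(t)\doteq\frac{1}{2^{n-1}}\sum_{k=0}^{(n-1)/2}(t-1)^{2k}(t+1)^{n-1-2k}\,\sigma_{2k}(q_1,\dots,q_n).$$ -/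

import Mathlib

open scoped LaurentPolynomial

/-- A link diagram, given by its planar diagram code. Besides the crossings (indexed by `X`) there
may be joints (indexed by `J`), points at which two edges of the diagram are glued end to end; `E`
indexes the edges. A crossing has four slots `0, 1, 2, 3`, listed counterclockwise around it, the
slots `0, 2` belonging to the lower strand and the slots `1, 3` to the upper strand. A joint has two
slots. `edge` tells which edge ends in a given slot, and every edge has exactly two ends. (That a
code be drawable in the plane is not asked for here; the pretzel codes below are.) -/
structure LinkDiagram (X J E : Type) where
  edge : (X × Fin 4) ⊕ (J × Fin 2) → E
  two_ends : ∀ e, ∃ a b, a ≠ b ∧ ∀ s, edge s = e ↔ s = a ∨ s = b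

namespace LinkDiagram

variable {X J E : Type}

/-- The edge ending in slot `k` of the crossing `x`. -/
def atCrossing (D : LinkDiagram X J E) (x : X) (k : Fin 4) : E := D.edge (Sum.inl (x, k))

/-- The edge ending in slot `k` of the joint `j`. -/
def atJoint (D : LinkDiagram X J E) (j : J) (k : Fin 2) : E := D.edge (Sum.inr (j, k))

/-- An orientation of the link: `incoming s` says whether the link runs into the crossing or joint
at the slot `s` (or out of it). Along each edge, along both strands of each crossing and through
each joint, the link comes in at one of the two slots and goes out at the other. -/
structure Orientation (D : LinkDiagram X J E) where
  incoming : (X × Fin 4) ⊕ (J × Fin 2) → Bool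
  along_edge : ∀ a b, a ≠ b → D.edge a = D.edge b → incoming a = !incoming b
  lower : ∀ x, incoming (Sum.inl (x, 2)) = !incoming (Sum.inl (x, 0))
  upper : ∀ x, incoming (Sum.inl (x, 3)) = !incoming (Sum.inl (x, 1))
  joint : ∀ j, incoming (Sum.inr (j, 1)) = !incoming (Sum.inr (j, 0))

/-- The edge of the lower strand of the crossing `x` on the left of the directed upper strand. (If
the upper strand runs from slot `1` to slot `3`, slot `0` is on its left and slot `2` on its right;
otherwise it is the other way round.) -/
def Orientation.left {D : LinkDiagram X J E} (o : D.Orientation) (x : X) : E :=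
  if o.incoming (Sum.inl (x, 1)) then D.atCrossing x 0 else D.atCrossing x 2

/-- The edge of the lower strand of the crossing `x` on the right of the directed upper strand. -/
def Orientation.right {D : LinkDiagram X J E} (o : D.Orientation) (x : X) : E :=
  if o.incoming (Sum.inl (x, 1)) then D.atCrossing x 2 else D.atCrossing x 0

/-- The Alexander matrix over `ℤ[t, t⁻¹]` of an oriented diagram. The columns are the edges, that
is, one variable is assigned to each edge. The rows are the linear relations:
* at each crossing, `(1 - t) * over + t * left - right = 0`;
* at each crossing, the two edges of the upper strand (parts of one arc) carry equal variables;
* at each joint, the two edges carry equal variables. -/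
noncomputable def Orientation.alexanderMatrix [DecidableEq E] {D : LinkDiagram X J E}
    (o : D.Orientation) : Matrix (X ⊕ X ⊕ J) E ℤ[T;T⁻¹] :=
  Matrix.of fun r => match r with
    | Sum.inl x =>
        Pi.single (D.atCrossing x 1) (1 - LaurentPolynomial.T 1)
          + Pi.single (o.left x) (LaurentPolynomial.T 1) - Pi.single (o.right x) 1
    | Sum.inr (Sum.inl x) => Pi.single (D.atCrossing x 1) 1 - Pi.single (D.atCrossing x 3) 1
    | Sum.inr (Sum.inr j) => Pi.single (D.atJoint j 0) 1 - Pi.single (D.atJoint j 1) 1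

/-- `Δ` is an Alexander polynomial of the diagram `D`: for some orientation, it is the determinant
of the Alexander matrix after deleting one row `r` and one column `c`. (The matrix is square, as the
edges have as many ends as the crossings and joints have slots; `σ` is any enumeration of the
remaining rows by the remaining columns, which affects the sign only.) -/
def IsAlexanderPolynomial [DecidableEq X] [DecidableEq J] [DecidableEq E] [Fintype X] [Fintype J]
    (D : LinkDiagram X J E) (Δ : ℤ[T;T⁻¹]) : Prop :=
  ∃ (o : D.Orientation) (r : X ⊕ X ⊕ J) (c : E) (σ : {r' // r' ≠ r} ≃ {c' // c' ≠ c}),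
    Δ = (o.alexanderMatrix.submatrix (fun i : {r' // r' ≠ r} => (i : X ⊕ X ⊕ J))
      (fun i => (σ i : E))).det

end LinkDiagram

/-- The edges of the pretzel diagram: the twist region `i`, a column of `|q i|` crossings, is cut
by its crossings into the levels `0, …, |q i|`, from top to bottom, and has at each level a left
edge (`false`) and a right edge (`true`). -/
abbrev PretzelEdge {n : ℕ} (q : Fin n → ℤ) : Type :=
  (i : Fin n) × (Fin ((q i).natAbs + 1) × Bool)

/-- The crossings of the pretzel diagram: in the twist region `i`, the crossing number `l` is
between the levels `l` and `l + 1`. -/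
abbrev PretzelCrossing {n : ℕ} (q : Fin n → ℤ) : Type := (i : Fin n) × Fin (q i).natAbs

/-- The four edges at a crossing of the pretzel diagram, listed counterclockwise from an end of the
lower strand: the latter goes from top left to bottom right if `0 < q i`, and from bottom left to
top right if `q i < 0`. -/
def pretzelAtCrossing {n : ℕ} (q : Fin n → ℤ) (x : PretzelCrossing q) : Fin 4 → PretzelEdge q :=
  let topLeft : PretzelEdge q := ⟨x.1, x.2.castSucc, false⟩
  let topRight : PretzelEdge q := ⟨x.1, x.2.castSucc, true⟩
  let bottomLeft : PretzelEdge q := ⟨x.1, x.2.succ, false⟩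
  let bottomRight : PretzelEdge q := ⟨x.1, x.2.succ, true⟩
  if 0 < q x.1 then ![topLeft, bottomLeft, bottomRight, topRight]
  else ![bottomLeft, bottomRight, topRight, topLeft]

/-- The two edges at a joint of the pretzel diagram: the right edge of the twist region `i` is
joined to the left edge of the cyclically next one, both at the top (`true`) and at the bottom
(`false`). -/
def pretzelAtJoint {n : ℕ} (q : Fin n → ℤ) (j : Fin n × Bool) : Fin 2 → PretzelEdge q :=
  if j.2 then ![⟨j.1, 0, true⟩, ⟨finRotate n j.1, 0, false⟩]
  else ![⟨j.1, Fin.last _, true⟩, ⟨finRotate n j.1, Fin.last _, false⟩]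

theorem pretzelEdge_ext {n : ℕ} {q : Fin n → ℤ} {i i' : Fin n} (l : Fin ((q i).natAbs + 1))
    (l' : Fin ((q i').natAbs + 1)) (b b' : Bool) :
    ((⟨i, l, b⟩ : PretzelEdge q) = ⟨i', l', b'⟩) ↔ i = i' ∧ (l : ℕ) = l' ∧ b = b' := by
  constructor
  · rintro ⟨⟩
    simp
  · rintro ⟨rfl, h, rfl⟩
    rw [Fin.ext h]

theorem pretzelCrossing_ext {n : ℕ} {q : Fin n → ℤ} {i i' : Fin n} (l : Fin (q i).natAbs)
    (l' : Fin (q i').natAbs) :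
    ((⟨i, l⟩ : PretzelCrossing q) = ⟨i', l'⟩) ↔ i = i' ∧ (l : ℕ) = l' := by
  constructor
  · rintro ⟨⟩
    simp
  · rintro ⟨rfl, h⟩
    rw [Fin.ext h]

/-- Whether an edge meets a slot of the pretzel diagram from below. -/
def pretzelBelow {n : ℕ} (q : Fin n → ℤ) :
    (PretzelCrossing q × Fin 4) ⊕ ((Fin n × Bool) × Fin 2) → Bool :=
  Sum.elim (fun s => (if 0 < q s.1.1 then ![false, true, true, false]
    else ![true, true, false, false]) s.2) (fun s => s.1.2)

/-- Every edge of the pretzel diagram has one upper end and one lower end. -/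
theorem pretzel_existsUnique {n : ℕ} (q : Fin n → ℤ) (e : PretzelEdge q) (u : Bool) :
    ∃ a, ∀ s, (Sum.elim (fun s => pretzelAtCrossing q s.1 s.2)
      (fun s => pretzelAtJoint q s.1 s.2) s = e ∧ pretzelBelow q s = u) ↔ s = a := by
  obtain ⟨i, l, b⟩ := e
  let P (a : (PretzelCrossing q × Fin 4) ⊕ ((Fin n × Bool) × Fin 2)) : Prop :=
    ∀ s, (Sum.elim (fun s => pretzelAtCrossing q s.1 s.2) (fun s => pretzelAtJoint q s.1 s.2) s
      = ⟨i, l, b⟩ ∧ pretzelBelow q s = u) ↔ s = a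
  suffices h : P (Sum.inr (if b then ((i, u), 0) else (((finRotate n).symm i, u), 1))) ∨
      ∃ (l' : Fin (q i).natAbs) (k : Fin 4), P (Sum.inl (⟨i, l'⟩, k)) by
    rcases h with h | ⟨l', k, h⟩
    exacts [⟨_, h⟩, ⟨_, h⟩]
  have hJ : (l : ℕ) = (if u then 0 else (q i).natAbs) →
      P (Sum.inr (if b then ((i, u), 0) else (((finRotate n).symm i, u), 1))) := by
    rintro hl (⟨⟨i', l'⟩, k⟩ | ⟨⟨i', _ | _⟩, k⟩)
    · by_cases hq' : 0 < q i' <;> fin_cases k <;>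
        simp [pretzelAtCrossing, pretzelBelow, hq', -Sigma.mk.injEq, pretzelEdge_ext] <;> grind
    all_goals
      fin_cases k <;> cases b <;> cases u <;>
        simp [pretzelAtJoint, pretzelBelow, -Sigma.mk.injEq, -finRotate_apply,
          -finRotate_symm_apply, pretzelEdge_ext, Equiv.eq_symm_apply] <;> grind
  have hX : ∀ (l' : Fin (q i).natAbs), (l : ℕ) = l' + (if u then 1 else 0) →
      P (Sum.inl (⟨i, l'⟩, if 0 < q i then (if u then (if b then 2 else 1) else if b then 3 else 0)
        else (if u then (if b then 1 else 0) else if b then 2 else 3))) := by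
    rintro l₀ hl (⟨⟨i', l'⟩, k⟩ | ⟨⟨i', _ | _⟩, k⟩)
    · by_cases hq' : 0 < q i' <;> fin_cases k <;> cases b <;> cases u <;>
        simp [pretzelAtCrossing, pretzelBelow, hq', -Sigma.mk.injEq, pretzelEdge_ext,
          pretzelCrossing_ext] <;> grind
    all_goals
      fin_cases k <;> cases u <;>
        simp [pretzelAtJoint, pretzelBelow, -Sigma.mk.injEq, -finRotate_apply, pretzelEdge_ext] <;>
        grind
  cases u
  · induction l using Fin.lastCases with
    | last => exact Or.inl (hJ rfl)
    | cast l => exact Or.inr ⟨l, _, hX l rfl⟩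
  · induction l using Fin.cases with
    | zero => exact Or.inl (hJ rfl)
    | succ l => exact Or.inr ⟨l, _, hX l rfl⟩

/-- The standard diagram of the pretzel link `P(q₁, …, qₙ)`. -/
def pretzel {n : ℕ} (q : Fin n → ℤ) :
    LinkDiagram (PretzelCrossing q) (Fin n × Bool) (PretzelEdge q) where
  edge := Sum.elim (fun s => pretzelAtCrossing q s.1 s.2) (fun s => pretzelAtJoint q s.1 s.2)
  two_ends e := by
    obtain ⟨a, ha⟩ := pretzel_existsUnique q e true
    obtain ⟨b, hb⟩ := pretzel_existsUnique q e false
    refine ⟨a, b, ?_, fun s => ?_⟩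
    · rintro rfl
      have h1 := ((ha a).2 rfl).2
      rw [((hb a).2 rfl).2] at h1
      exact Bool.noConfusion h1
    · rw [← ha s, ← hb s]
      cases pretzelBelow q s <;> simp

/-- The inclusion of `ℤ[t, t⁻¹]` into the field of rational functions. -/
noncomputable def laurentToRatFunc : ℤ[T;T⁻¹] →+* RatFunc ℚ :=
  LaurentPolynomial.eval₂ (Int.castRingHom (RatFunc ℚ)) (Units.mk0 RatFunc.X RatFunc.X_ne_zero)

/-- Equality up to multiplication by `± t ^ k` for some integer `k`. -/
def EqUpToUnit (f g : RatFunc ℚ) : Prop :=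
  ∃ k : ℤ, f = RatFunc.X ^ k * g ∨ f = -(RatFunc.X ^ k * g)

/-- The Alexander polynomial of `D` is `f` up to `± t ^ k`, that is, the Alexander polynomial exists, and
no matter which orientation, row and column are used to compute it, it is `f` up to `± t ^ k`. -/
def LinkDiagram.AlexanderPolynomialEq {X J E : Type} [DecidableEq X] [DecidableEq J]
    [DecidableEq E] [Fintype X] [Fintype J] (D : LinkDiagram X J E) (f : RatFunc ℚ) : Prop :=
  (∃ Δ, D.IsAlexanderPolynomial Δ) ∧ ∀ Δ, D.IsAlexanderPolynomial Δ → EqUpToUnit (laurentToRatFunc Δ) f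

/-- The elementary symmetric polynomial `σ_k(q₁, …, qₙ)`. -/
def sigma {n : ℕ} (k : ℕ) (q : Fin n → ℤ) : ℤ :=
  ∑ s ∈ Finset.powersetCard k Finset.univ, ∏ i ∈ s, q i

/-!
The Alexander matrix is regarded over a field `K` with a distinguished element `t ≠ 0`. A direction
(up or down) of every edge encodes the orientation.

*All minors agree.* The rows of the matrix sum to zero (`mulVec_one`), and there is an explicit linear
dependency between the rows whose coefficients are all `± t ^ k` (`rowWeight_vecMul`): every edge gets
the weight `± t ^ k` with `k` from the Alexander numbering of the regions, and then the rows of each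
crossing and joint add up to the weighted sum of its ends, while the two ends of each edge cancel.
Hence all entries of the adjugate, that is, all minors, agree up to `± t ^ k`.

*One minor.* From top to bottom, the crossings of a twist region determine all colours from
the top ones. If the top edges have the colours `0` and `1`, the bottom left one
gets the colour `α` (`bottomLeft`) and the bottom right one the colour `1 + γ` (`bottomRight`). By the top
joints a colouring is given by the colours `x i` of the top left edges, and with
`d i = x (i + 1) - x i` the bottom joints say `γ i * d i = α (i + 1) * d (i + 1)`. So the elimination of
all other variables, which is triangular with units on the diagonal, leaves the determinant of these
equations together with `∑ d i = 0`, which is the chain sum `∑ i, (∏ k < i, γ k) * ∏ k > i, α k`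
(`exists_adjugate_eq_chainSum`).

*Evaluation.* Let `w` be `t` or `t⁻¹` as the top right edge runs up or down. If the two
strands are parallel, then `α = (1 - (-w) ^ q) / (1 + w)` and `γ = -w * α`; if they are antiparallel,
`α` and `γ` are linear in `q`. If all twist regions are odd, all of them are antiparallel with
the same `w`, `α - γ = 1 + w`, and the chain sum telescopes to `(∏ α - ∏ γ) / (1 + w)`. If the twist region
`j` is even, the other ones are parallel, with alternating directions, and the products of the
factors `-w` in the chain sum are alternately `1` and `-t`, up to a common factor. What remains is to
count the twist regions that are directed upwards, which is done by summing over the top joints; the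
same count shows that the twist region `j` is parallel if and only if `n` is even.
-/

open scoped Matrix

/-! ### Determinants -/

namespace Matrix

variable {ι R : Type*} [Fintype ι] [DecidableEq ι]

/-- A matrix that is triangular with respect to a rank function (two different indices of equal rank
carry a zero entry) has the product of its diagonal entries as determinant: a permutation that
never lowers the rank preserves the sum of the ranks, hence never raises it either. -/
theorem det_eq_prod_diag_of_rank [CommRing R] (A : Matrix ι ι R) (f : ι → ℕ)
    (h : ∀ i j, A i j ≠ 0 → i = j ∨ f j < f i) : A.det = ∏ i, A i i := by
  rw [det_apply, Finset.sum_eq_single (1 : Equiv.Perm ι)]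
  · simp
  · intro σ _ hσ
    by_contra hne
    have hne' : ∀ i, A (σ i) i ≠ 0 := by
      intro i hi
      have hp : ∏ i, A (σ i) i = 0 := Finset.prod_eq_zero (Finset.mem_univ i) hi
      exact hne (by rw [hp, smul_zero])
    have hle : ∀ i, σ i = i ∨ f i < f (σ i) := fun i => h _ _ (hne' i)
    obtain ⟨i, hi⟩ : ∃ i, σ i ≠ i := by
      by_contra hcon
      push Not at hcon
      exact hσ (Equiv.ext hcon)
    have hlt : ∑ i, f i < ∑ i, f (σ i) :=
      Finset.sum_lt_sum (fun i _ => (hle i).elim (fun e => by rw [e]) le_of_lt)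
        ⟨i, Finset.mem_univ i, (hle i).resolve_left hi⟩
    rw [Equiv.sum_comp σ f] at hlt
    exact lt_irrefl _ hlt
  · simp

/-- The minor of a matrix with one row and one column deleted is, up to sign, an entry of the
adjugate, for any identification `ψ` of the rows with the columns. -/
theorem det_submatrix_ne_eq_adjugate [CommRing R] {κ : Type*} [Fintype κ] [DecidableEq κ]
    (M : Matrix ι κ R) (ψ : ι ≃ κ) (r : ι) (c : κ) (σ : {i // i ≠ r} ≃ {j // j ≠ c}) :
    ∃ ε : ℤˣ, (M.submatrix (fun i : {i // i ≠ r} => (i : ι)) (fun i => (σ i : κ))).det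
      = ((ε : ℤ) : R) * (M.submatrix id ψ).adjugate (ψ.symm c) r := by
  -- `τ` extends `σ` by `r ↦ c`
  let τ : ι ≃ κ := (Equiv.sumCompl (fun i => i = r)).symm.trans
    (((Equiv.ofUnique {i // i = r} {j // j = c}).sumCongr σ).trans (Equiv.sumCompl (fun j => j = c)))
  have τr : τ r = c := by
    simp only [τ, Equiv.trans_apply]
    rw [Equiv.sumCompl_symm_apply_of_pos (p := fun i => i = r) rfl]
    simp only [Equiv.sumCongr_apply, Sum.map_inl, Equiv.sumCompl_apply_inl]
    exact (Equiv.ofUnique {i // i = r} {j // j = c} ⟨r, rfl⟩).2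
  have τne : ∀ i : {i // i ≠ r}, τ i = σ i := by
    intro i
    simp only [τ, Equiv.trans_apply]
    rw [Equiv.sumCompl_symm_apply_of_neg (p := fun i => i = r) i.2]
    rfl
  let N : Matrix ι ι R := ((M.submatrix id ψ).updateRow r (Pi.single (ψ.symm c) 1))
  refine ⟨Equiv.Perm.sign (τ.trans ψ.symm), ?_⟩
  rw [adjugate_apply, ← det_permute' (τ.trans ψ.symm) N,
    twoBlockTriangular_det' _ (fun i => i = r)]
  · refine Eq.symm ((congrArg₂ (· * ·) ?_ ?_).trans (one_mul _))
    · refine (@det_eq_elem_of_subsingleton _ _ (_) _ _ _ _ ⟨r, rfl⟩).trans ?_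
      simp [toSquareBlockProp, N, τr]
    · congr 1
      ext i j
      have hi : (i : ι) ≠ r := i.2
      simp [toSquareBlockProp, N, updateRow_ne hi, τne]
  · rintro i rfl j hj
    simp only [N, submatrix_apply, id, updateRow_self]
    refine Pi.single_eq_of_ne ?_ _
    simp only [Equiv.trans_apply, ne_eq, EmbeddingLike.apply_eq_iff_eq]
    intro e
    exact hj (τ.injective (e.trans τr.symm))

/-- If the rows of `B` sum to zero, all entries in a column of the adjugate agree. -/
theorem adjugate_eq_of_mulVec_one [CommRing R] [IsDomain R] (B : Matrix ι ι R)
    (h : B *ᵥ (fun _ => 1) = 0) (s s' r : ι) : B.adjugate s r = B.adjugate s' r := by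
  rw [adjugate_apply, adjugate_apply, ← sub_eq_zero]
  have h0 : (B.updateRow r (Pi.single s 1 + (-1 : R) • Pi.single s' 1)).det = 0 := by
    rw [← exists_mulVec_eq_zero_iff]
    refine ⟨fun _ => 1, fun e => one_ne_zero (congrFun e r), ?_⟩
    ext i
    by_cases hi : i = r
    · subst hi
      simp [mulVec, dotProduct, Finset.sum_add_distrib]
    · have := congrFun h i
      simpa [mulVec, dotProduct, updateRow_ne hi] using this
  rw [det_updateRow_add, det_updateRow_smul] at h0
  rw [← h0]
  ring

/-- A linear dependency `v` between the rows of `B` is proportional to the rows of the adjugate. -/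
theorem mul_adjugate_eq_of_vecMul [CommRing R] [IsDomain R] (B : Matrix ι ι R) (v : ι → R)
    (h : v ᵥ* B = 0) (s r r' : ι) : v r' * B.adjugate s r = v r * B.adjugate s r' := by
  have key : ∀ r, B.adjugate s r = (Bᵀ.updateRow s (Pi.single r 1)).det := by
    intro r
    rw [← adjugate_apply, ← adjugate_transpose, transpose_apply]
  by_cases hv : v = 0
  · simp [hv]
  rw [key, key, ← sub_eq_zero]
  have h0 : (Bᵀ.updateRow s (v r' • Pi.single r 1 + (- v r) • Pi.single r' 1)).det = 0 := by
    rw [← exists_mulVec_eq_zero_iff]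
    refine ⟨v, hv, ?_⟩
    ext i
    by_cases hi : i = s
    · subst hi
      simp only [mulVec, updateRow_self, add_dotProduct, smul_dotProduct, single_dotProduct,
        smul_eq_mul, Pi.zero_apply]
      ring
    · have := congrFun h i
      rw [vecMul, dotProduct_comm] at this
      simpa [mulVec, updateRow_ne hi] using this
  rw [det_updateRow_add, det_updateRow_smul, det_updateRow_smul] at h0
  rw [← h0]
  ring

end Matrix

/-- The matrix of the equations `γ i * d i = α (i + 1) * d (i + 1)`, `i < m`, and `- ∑ i, d i = 0`
in the variables `d 0, …, d m`. -/
def chainMatrix {R : Type*} [CommRing R] {m : ℕ} (α γ : Fin (m + 1) → R) :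
    Matrix (Fin (m + 1)) (Fin (m + 1)) R :=
  Matrix.of fun i k => if i = Fin.last m then -1 else
    (if (k : ℕ) = i then γ k else 0) - (if (k : ℕ) = i + 1 then α k else 0)

/-- The sum `∑ i, (∏ k < i, γ k) * ∏ k > i, α k`. -/
def chainSum {R : Type*} [CommRing R] {m : ℕ} (α γ : Fin m → R) : R :=
  ∑ i, ∏ k, if k < i then γ k else if i < k then α k else 1

theorem chainSum_succ {R : Type*} [CommRing R] {m : ℕ} (α γ : Fin (m + 1) → R) :
    chainSum α γ = ∏ k : Fin m, α k.succ
      + γ 0 * chainSum (fun k => α k.succ) (fun k => γ k.succ) := by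
  simp [chainSum, Fin.sum_univ_succ, Fin.prod_univ_succ, Finset.mul_sum]

theorem det_chainMatrix {R : Type*} [CommRing R] {m : ℕ} (α γ : Fin (m + 1) → R) :
    (chainMatrix α γ).det = - chainSum α γ := by
  induction m with
  | zero => simp [chainMatrix, chainSum]
  | succ m ih =>
    have hmid : ∀ i : Fin m, chainMatrix α γ i.castSucc.succ 0 = 0 := by
      intro i
      have : i.castSucc.succ ≠ Fin.last (m + 1) := by
        rw [ne_eq, Fin.ext_iff]; simp; omega
      simp [chainMatrix, this]
    have hlast : ((chainMatrix α γ).submatrix (Fin.last (m + 1)).succAbove Fin.succ).det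
        = (-1) ^ (m + 1) * ∏ k : Fin (m + 1), α k.succ := by
      rw [Matrix.det_eq_prod_diag_of_rank _ (fun i : Fin (m + 1) => (i : ℕ))]
      · have hc : (-1 : R) ^ (m + 1) = ∏ _k : Fin (m + 1), (-1 : R) := by simp
        rw [hc, ← Finset.prod_mul_distrib]
        refine Finset.prod_congr rfl fun i _ => ?_
        simp [chainMatrix, (Fin.castSucc_lt_last i).ne]
      · intro i j hij
        by_contra! hcon
        apply hij
        have h1 : (j : ℕ) + 1 ≠ i := by omega
        have h2 : (j : ℕ) ≠ i := fun e => hcon.1 (Fin.ext e.symm)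
        simp [chainMatrix, (Fin.castSucc_lt_last i).ne, h1, h2]
    have hzero : (chainMatrix α γ).submatrix (Fin.succAbove 0) Fin.succ
        = chainMatrix (fun k => α k.succ) (fun k => γ k.succ) := by
      ext i j
      by_cases hi : i = Fin.last m
      · subst hi; simp [chainMatrix]
      · have : i.succ ≠ Fin.last (m + 1) := by
          rwa [← Fin.succ_last, ne_eq, Fin.succ_inj]
        simp [chainMatrix, hi, this]
    rw [Matrix.det_succ_column_zero, Fin.sum_univ_succ, Fin.sum_univ_castSucc,
      Finset.sum_eq_zero (fun i _ => by rw [hmid i]; ring), Fin.succ_last, hlast, hzero, ih,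
      chainSum_succ α γ]
    have h00 : chainMatrix α γ 0 0 = γ 0 := by
      have : (0 : Fin (m + 2)) ≠ Fin.last (m + 1) := (Fin.last_pos).ne
      simp [chainMatrix, this]
    have hl0 : chainMatrix α γ (Fin.last (m + 1)) 0 = -1 := by simp [chainMatrix]
    rw [h00, hl0]
    have hs : ((-1 : R) ^ (m + 1)) * (-1) ^ (m + 1) = 1 := by
      rw [← mul_pow]; simp
    simp only [Fin.val_zero, Fin.val_last, pow_zero, Nat.succ_eq_add_one]
    linear_combination (-∏ k : Fin (m + 1), α k.succ) * hs

/-! ### Directions of the edges -/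

section Directions

variable {n : ℕ} {q : Fin n → ℤ}

/-- The direction of the link along an edge of the pretzel diagram: `true` if it runs upwards. -/
noncomputable def pretzelUp (o : (pretzel q).Orientation) (e : PretzelEdge q) : Bool :=
  o.incoming (pretzel_existsUnique q e true).choose

theorem incoming_eq (o : (pretzel q).Orientation)
    (s : (PretzelCrossing q × Fin 4) ⊕ ((Fin n × Bool) × Fin 2)) :
    o.incoming s = (pretzelUp o ((pretzel q).edge s) == pretzelBelow q s) := by
  have hup := (pretzel_existsUnique q ((pretzel q).edge s) true).choose_spec
  rw [pretzelUp]
  set a := (pretzel_existsUnique q ((pretzel q).edge s) true).choose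
  cases hs : pretzelBelow q s
  · have ha := (hup a).2 rfl
    have hne : s ≠ a := by
      rintro h
      rw [← h, hs] at ha
      exact Bool.noConfusion ha.2
    rw [o.along_edge s a hne ha.1.symm]
    simp
  · rw [← (hup s).1 ⟨rfl, hs⟩]
    simp

/-- An assignment of directions to the edges that is compatible with the crossings and joints:
strands go on through a crossing, and turn back at a joint. -/
structure IsCoherent (u : PretzelEdge q → Bool) : Prop where
  crossing : ∀ (i : Fin n) (l : Fin (q i).natAbs) (b : Bool),
    u ⟨i, l.succ, b⟩ = u ⟨i, l.castSucc, !b⟩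
  top : ∀ i, u ⟨finRotate n i, 0, false⟩ = !u ⟨i, 0, true⟩
  bottom : ∀ i, u ⟨finRotate n i, Fin.last _, false⟩ = !u ⟨i, Fin.last _, true⟩

theorem isCoherent_pretzelUp (o : (pretzel q).Orientation) : IsCoherent (pretzelUp o) where
  crossing i l b := by
    have h1 := o.lower ⟨i, l⟩
    have h2 := o.upper ⟨i, l⟩
    simp only [incoming_eq] at h1 h2
    by_cases hq : 0 < q i <;> cases b <;>
      simp_all [pretzel, pretzelAtCrossing, pretzelBelow]
  top i := by
    have h := o.joint (i, true)
    simp only [incoming_eq] at h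
    simpa [pretzel, pretzelAtJoint, pretzelBelow] using h
  bottom i := by
    have h := o.joint (i, false)
    simp only [incoming_eq] at h
    simpa [pretzel, pretzelAtJoint, pretzelBelow] using h

theorem IsCoherent.nonempty_orientation {u : PretzelEdge q → Bool} (hu : IsCoherent u) :
    Nonempty (pretzel q).Orientation := by
  refine ⟨⟨fun s => u ((pretzel q).edge s) == pretzelBelow q s, ?_, ?_, ?_, ?_⟩⟩
  · intro a b hab he
    have hne : pretzelBelow q a ≠ pretzelBelow q b := by
      intro h
      obtain ⟨s, hs⟩ := pretzel_existsUnique q ((pretzel q).edge a) (pretzelBelow q a)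
      exact hab (((hs a).1 ⟨rfl, rfl⟩).trans ((hs b).1 ⟨he.symm, h.symm⟩).symm)
    rw [he]
    revert hne
    cases pretzelBelow q a <;> cases pretzelBelow q b <;> simp
  · rintro ⟨i, l⟩
    by_cases hq : 0 < q i <;>
      simp [pretzel, pretzelAtCrossing, pretzelBelow, hq, hu.crossing]
  · rintro ⟨i, l⟩
    by_cases hq : 0 < q i <;>
      simp [pretzel, pretzelAtCrossing, pretzelBelow, hq, hu.crossing]
  · rintro ⟨i, b⟩
    have h1 := hu.top i
    have h2 := hu.bottom i
    cases b <;> simp_all [pretzel, pretzelAtJoint, pretzelBelow]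

/-- The side (`false` for left) of the edge in which the upper strand leaves a crossing of the twist
region `i` downwards. -/
def overSide (q : Fin n → ℤ) (i : Fin n) : Bool := !decide (0 < q i)

theorem atCrossing_one (i : Fin n) (l : Fin (q i).natAbs) :
    (pretzel q).atCrossing ⟨i, l⟩ 1 = ⟨i, l.succ, overSide q i⟩ := by
  by_cases hq : 0 < q i <;>
    simp [LinkDiagram.atCrossing, pretzel, pretzelAtCrossing, overSide, hq]

theorem atCrossing_three (i : Fin n) (l : Fin (q i).natAbs) :
    (pretzel q).atCrossing ⟨i, l⟩ 3 = ⟨i, l.castSucc, !overSide q i⟩ := by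
  by_cases hq : 0 < q i <;>
    simp [LinkDiagram.atCrossing, pretzel, pretzelAtCrossing, overSide, hq]

theorem left_eq (o : (pretzel q).Orientation) (i : Fin n) (l : Fin (q i).natAbs) :
    o.left ⟨i, l⟩ = if pretzelUp o ⟨i, l.succ, overSide q i⟩ = overSide q i
      then ⟨i, l.succ, !overSide q i⟩ else ⟨i, l.castSucc, overSide q i⟩ := by
  rw [LinkDiagram.Orientation.left, incoming_eq]
  by_cases hq : 0 < q i
  · cases hu : pretzelUp o ⟨i, l.succ, false⟩ <;>
      simp [LinkDiagram.atCrossing, pretzel, pretzelAtCrossing, pretzelBelow, overSide, hq, hu]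
  · cases hu : pretzelUp o ⟨i, l.succ, true⟩ <;>
      simp [LinkDiagram.atCrossing, pretzel, pretzelAtCrossing, pretzelBelow, overSide, hq, hu]

theorem right_eq (o : (pretzel q).Orientation) (i : Fin n) (l : Fin (q i).natAbs) :
    o.right ⟨i, l⟩ = if pretzelUp o ⟨i, l.succ, overSide q i⟩ = overSide q i
      then ⟨i, l.castSucc, overSide q i⟩ else ⟨i, l.succ, !overSide q i⟩ := by
  rw [LinkDiagram.Orientation.right, incoming_eq]
  by_cases hq : 0 < q i
  · cases hu : pretzelUp o ⟨i, l.succ, false⟩ <;>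
      simp [LinkDiagram.atCrossing, pretzel, pretzelAtCrossing, pretzelBelow, overSide, hq, hu]
  · cases hu : pretzelUp o ⟨i, l.succ, true⟩ <;>
      simp [LinkDiagram.atCrossing, pretzel, pretzelAtCrossing, pretzelBelow, overSide, hq, hu]

/-- Every edge has one upper and one lower end, so a sum over all ends of edges, taken with opposite
signs for upper and lower ends, vanishes. -/
theorem sum_ends_eq_zero {K : Type*} [AddCommGroup K] (g : PretzelEdge q → K) :
    ∑ s, (if pretzelBelow q s then g ((pretzel q).edge s) else - g ((pretzel q).edge s)) = 0 := by
  have key : ∀ b : Bool, ∑ s with pretzelBelow q s = b, g ((pretzel q).edge s) = ∑ e, g e := by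
    intro b
    refine Finset.sum_bij (fun s _ => (pretzel q).edge s) (by simp) ?_ ?_ (by simp)
    · intro a ha a' ha' h
      simp only [Finset.mem_filter, Finset.mem_univ, true_and] at ha ha'
      obtain ⟨s, hs⟩ := pretzel_existsUnique q ((pretzel q).edge a) b
      exact ((hs a).1 ⟨rfl, ha⟩).trans ((hs a').1 ⟨h.symm, ha'⟩).symm
    · intro e _
      obtain ⟨s, hs⟩ := pretzel_existsUnique q e b
      obtain ⟨h1, h2⟩ := (hs s).2 rfl
      exact ⟨s, by simpa using h2, h1⟩
  have h1 := key true
  have h2 := key false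
  rw [Finset.sum_ite, h1, Finset.sum_neg_distrib]
  simp only [Bool.not_eq_true]
  rw [h2, add_neg_cancel]

end Directions

/-! ### The equations of a colouring -/

section Equations

variable {n : ℕ} {q : Fin n → ℤ} {K : Type*} [Field K] (f : ℤ[T;T⁻¹] →+* K)

theorem apply_T_one_ne_zero : f (LaurentPolynomial.T 1) ≠ 0 := by
  intro h
  have : f (LaurentPolynomial.T 1 * LaurentPolynomial.T (-1)) = 1 := by
    rw [← LaurentPolynomial.T_add]; simp
  rw [map_mul, h, zero_mul] at this
  exact zero_ne_one this

/-- `t` or `t⁻¹`. -/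
def signPow (t : K) (b : Bool) : K := if b then t else t⁻¹

theorem signPow_ne_zero {t : K} (ht : t ≠ 0) (b : Bool) : signPow t b ≠ 0 := by
  cases b <;> simp [signPow, ht]

/-- `± t ^ k`. -/
def IsSignedPow (t x : K) : Prop := ∃ k : ℤ, x = t ^ k ∨ x = -t ^ k

namespace IsSignedPow

variable {t x y : K}

theorem one : IsSignedPow t 1 := ⟨0, by simp⟩

theorem neg (h : IsSignedPow t x) : IsSignedPow t (-x) := by
  obtain ⟨k, rfl | rfl⟩ := h
  exacts [⟨k, Or.inr rfl⟩, ⟨k, Or.inl (neg_neg _)⟩]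

theorem mul (ht : t ≠ 0) (h : IsSignedPow t x) (h' : IsSignedPow t y) : IsSignedPow t (x * y) := by
  obtain ⟨k, rfl | rfl⟩ := h <;> obtain ⟨k', rfl | rfl⟩ := h' <;>
    refine ⟨k + k', ?_⟩ <;> simp [zpow_add₀ ht]

theorem inv (h : IsSignedPow t x) : IsSignedPow t x⁻¹ := by
  obtain ⟨k, rfl | rfl⟩ := h <;> refine ⟨-k, ?_⟩ <;> simp [inv_neg]

theorem div (ht : t ≠ 0) (h : IsSignedPow t x) (h' : IsSignedPow t y) :
    IsSignedPow t (x / y) := by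
  rw [div_eq_mul_inv]; exact h.mul ht h'.inv

theorem self : IsSignedPow t t := ⟨1, by simp⟩

theorem zpow (k : ℤ) : IsSignedPow t (t ^ k) := ⟨k, Or.inl rfl⟩

theorem signPow (b : Bool) : IsSignedPow t (signPow t b) := by
  cases b
  exacts [self.inv, self]

theorem ne_zero (ht : t ≠ 0) (h : IsSignedPow t x) : x ≠ 0 := by
  obtain ⟨k, rfl | rfl⟩ := h
  exacts [zpow_ne_zero _ ht, neg_ne_zero.2 (zpow_ne_zero _ ht)]

theorem prod {ι : Type*} (ht : t ≠ 0) (s : Finset ι) {g : ι → K}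
    (h : ∀ i ∈ s, IsSignedPow t (g i)) : IsSignedPow t (∏ i ∈ s, g i) :=
  Finset.prod_induction g (IsSignedPow t) (fun _ _ => IsSignedPow.mul ht) one h

end IsSignedPow

/-- The power `s = t ^ (± 1)` for which the relation at a crossing becomes
`z = (1 - s) * x + s * y`, where `x` is the colour of the upper strand, and `y` and `z` are the
colours of the lower strand above and below the crossing. -/
noncomputable def crossingPow (t : K) (u : PretzelEdge q → Bool) (i : Fin n)
    (l : Fin (q i).natAbs) : K :=
  signPow t (xor (u ⟨i, l.succ, overSide q i⟩) (overSide q i))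

/-- The factor `1` or `-t` by which the relation in the Alexander matrix differs from the
relation `(1 - s) * x + s * y - z = 0`, see `crossingPow`. -/
def crossingFactor (t : K) (u : PretzelEdge q → Bool) (i : Fin n) (l : Fin (q i).natAbs) : K :=
  if u ⟨i, l.succ, overSide q i⟩ = overSide q i then -t else 1

theorem isSignedPow_crossingFactor (t : K) (u : PretzelEdge q → Bool) (i : Fin n)
    (l : Fin (q i).natAbs) : IsSignedPow t (crossingFactor t u i l) := by
  rw [crossingFactor]
  split_ifs
  exacts [IsSignedPow.self.neg, IsSignedPow.one]

theorem sum_map_single_mul {E : Type*} [Fintype E] [DecidableEq E] (e : E) (a : ℤ[T;T⁻¹])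
    (c : E → K) : ∑ x, f ((Pi.single e a : E → ℤ[T;T⁻¹]) x) * c x = f a * c e := by
  rw [Finset.sum_eq_single e]
  · simp
  · intro b _ hb
    simp [Pi.single_eq_of_ne hb]
  · simp

theorem mulVec_crossing (o : (pretzel q).Orientation) (c : PretzelEdge q → K) (i : Fin n)
    (l : Fin (q i).natAbs) :
    ((o.alexanderMatrix.map f) *ᵥ c) (Sum.inl ⟨i, l⟩) =
      crossingFactor (f (LaurentPolynomial.T 1)) (pretzelUp o) i l *
      ((1 - crossingPow (f (LaurentPolynomial.T 1)) (pretzelUp o) i l) * c ⟨i, l.succ, overSide q i⟩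
        + crossingPow (f (LaurentPolynomial.T 1)) (pretzelUp o) i l * c ⟨i, l.castSucc, overSide q i⟩
        - c ⟨i, l.succ, !overSide q i⟩) := by
  have ht := apply_T_one_ne_zero f
  simp only [Matrix.mulVec, dotProduct, Matrix.map_apply, LinkDiagram.Orientation.alexanderMatrix,
    Matrix.of_apply, Pi.add_apply, Pi.sub_apply, map_add, map_sub, add_mul, sub_mul,
    Finset.sum_add_distrib, Finset.sum_sub_distrib, sum_map_single_mul, left_eq, right_eq,
    atCrossing_one, crossingFactor, crossingPow, signPow, map_one]
  cases pretzelUp o ⟨i, l.succ, overSide q i⟩ <;> cases overSide q i <;> simp <;> field_simp <;> ring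

theorem mulVec_over (o : (pretzel q).Orientation) (c : PretzelEdge q → K) (i : Fin n)
    (l : Fin (q i).natAbs) :
    ((o.alexanderMatrix.map f) *ᵥ c) (Sum.inr (Sum.inl ⟨i, l⟩)) =
      c ⟨i, l.succ, overSide q i⟩ - c ⟨i, l.castSucc, !overSide q i⟩ := by
  simp only [Matrix.mulVec, dotProduct, Matrix.map_apply, LinkDiagram.Orientation.alexanderMatrix,
    Matrix.of_apply, Pi.sub_apply, map_sub, sub_mul,
    Finset.sum_sub_distrib, sum_map_single_mul, atCrossing_one, atCrossing_three, map_one, one_mul]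

theorem mulVec_top (o : (pretzel q).Orientation) (c : PretzelEdge q → K) (i : Fin n) :
    ((o.alexanderMatrix.map f) *ᵥ c) (Sum.inr (Sum.inr (i, true))) =
      c ⟨i, 0, true⟩ - c ⟨finRotate n i, 0, false⟩ := by
  simp only [Matrix.mulVec, dotProduct, Matrix.map_apply, LinkDiagram.Orientation.alexanderMatrix,
    Matrix.of_apply, Pi.sub_apply, map_sub, sub_mul,
    Finset.sum_sub_distrib, sum_map_single_mul, map_one, one_mul]
  rfl

theorem mulVec_bottom (o : (pretzel q).Orientation) (c : PretzelEdge q → K) (i : Fin n) :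
    ((o.alexanderMatrix.map f) *ᵥ c) (Sum.inr (Sum.inr (i, false))) =
      c ⟨i, Fin.last _, true⟩ - c ⟨finRotate n i, Fin.last _, false⟩ := by
  simp only [Matrix.mulVec, dotProduct, Matrix.map_apply, LinkDiagram.Orientation.alexanderMatrix,
    Matrix.of_apply, Pi.sub_apply, map_sub, sub_mul,
    Finset.sum_sub_distrib, sum_map_single_mul, map_one, one_mul]
  rfl

theorem mulVec_one (o : (pretzel q).Orientation) :
    (o.alexanderMatrix.map f) *ᵥ (fun _ => 1) = 0 := by
  ext r
  rcases r with ⟨i, l⟩ | ⟨i, l⟩ | ⟨i, _ | _⟩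
  · rw [mulVec_crossing]; simp
  · rw [mulVec_over]; simp
  · rw [mulVec_bottom]; simp
  · rw [mulVec_top]; simp

end Equations

/-! ### The linear dependency between the rows -/

section Dependency

variable {n : ℕ} {q : Fin n → ℤ} {K : Type*} [Field K]

theorem IsCoherent.eq_top {u : PretzelEdge q → Bool} (hu : IsCoherent u) (i : Fin n)
    (l : Fin ((q i).natAbs + 1)) (b : Bool) :
    u ⟨i, l, b⟩ = u ⟨i, 0, xor b (decide (Odd (l : ℕ)))⟩ := by
  induction l using Fin.induction generalizing b with
  | zero => simp
  | succ l ih =>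
    rw [hu.crossing, ih]
    congr 3
    by_cases h : Odd (l : ℕ) <;> cases b <;> simp [h, Nat.odd_add_one]

/-- The weight of an edge in the linear dependency between the rows of the Alexander matrix. It is
`± t ^ k` where the sign is given by the direction of the edge and `k` is the smaller one of the
Alexander numbers of the regions on both sides. Here the outer region above the twist regions has
the number `0`, and the number drops or rises by one when an edge is crossed from left to right,
according to whether it runs upwards or downwards. -/
noncomputable def edgeWeight (t : K) (u : PretzelEdge q → Bool) (e : PretzelEdge q) : K :=
  (signPow t (!u ⟨e.1, 0, false⟩))⁻¹ *
    ((if e.2.2 then signPow t (!u ⟨e.1, e.2.1, false⟩) else 1) * if u e then -t⁻¹ else 1)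

theorem isSignedPow_edgeWeight {t : K} (ht : t ≠ 0) (u : PretzelEdge q → Bool)
    (e : PretzelEdge q) : IsSignedPow t (edgeWeight t u e) := by
  refine (IsSignedPow.signPow _).inv.mul ht (IsSignedPow.mul ht ?_ ?_)
  · split_ifs
    exacts [IsSignedPow.signPow _, IsSignedPow.one]
  · split_ifs
    exacts [IsSignedPow.self.inv.neg, IsSignedPow.one]

/-- The rows of the Alexander matrix of the pretzel diagram: the crossing relations, the equalities
at the crossings, and the equalities at the joints. -/
abbrev AlexanderRow {n : ℕ} (q : Fin n → ℤ) : Type :=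
  PretzelCrossing q ⊕ PretzelCrossing q ⊕ (Fin n × Bool)

/-- The coefficients of the linear dependency between the rows of the Alexander matrix. -/
noncomputable def rowWeight (t : K) (u : PretzelEdge q → Bool) :
    AlexanderRow q → K
  | Sum.inl ⟨i, l⟩ => - edgeWeight t u ⟨i, l.succ, !overSide q i⟩ / crossingFactor t u i l
  | Sum.inr (Sum.inl ⟨i, l⟩) => edgeWeight t u ⟨i, l.castSucc, !overSide q i⟩
  | Sum.inr (Sum.inr (i, true)) => edgeWeight t u ⟨i, 0, true⟩
  | Sum.inr (Sum.inr (i, false)) => - edgeWeight t u ⟨i, Fin.last _, true⟩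

theorem isSignedPow_rowWeight {t : K} (ht : t ≠ 0) (u : PretzelEdge q → Bool)
    (r : AlexanderRow q) :
    IsSignedPow t (rowWeight t u r) := by
  rcases r with ⟨i, l⟩ | ⟨i, l⟩ | ⟨i, _ | _⟩
  · exact (isSignedPow_edgeWeight ht u _).neg.div ht (isSignedPow_crossingFactor t u i l)
  · exact isSignedPow_edgeWeight ht u _
  · exact (isSignedPow_edgeWeight ht u _).neg
  · exact isSignedPow_edgeWeight ht u _

theorem edgeWeight_under {t : K} (ht : t ≠ 0) {u : PretzelEdge q → Bool} (hu : IsCoherent u)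
    (i : Fin n) (l : Fin (q i).natAbs) :
    edgeWeight t u ⟨i, l.castSucc, overSide q i⟩
      = crossingPow t u i l * edgeWeight t u ⟨i, l.succ, !overSide q i⟩ := by
  simp only [edgeWeight, crossingPow]
  cases overSide q i <;> simp only [Bool.not_false, Bool.not_true] <;>
    cases h1 : u ⟨i, l.castSucc, true⟩ <;> cases h2 : u ⟨i, l.castSucc, false⟩ <;>
    cases h3 : u ⟨i, 0, false⟩ <;>
    simp [signPow, h1, h2, ht, hu.crossing]

theorem edgeWeight_over {t : K} (ht : t ≠ 0) {u : PretzelEdge q → Bool} (hu : IsCoherent u)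
    (i : Fin n) (l : Fin (q i).natAbs) :
    edgeWeight t u ⟨i, l.succ, overSide q i⟩ = edgeWeight t u ⟨i, l.castSucc, !overSide q i⟩
      - (1 - crossingPow t u i l) * edgeWeight t u ⟨i, l.succ, !overSide q i⟩ := by
  simp only [edgeWeight, crossingPow]
  cases overSide q i <;> simp only [Bool.not_false, Bool.not_true] <;>
    cases h1 : u ⟨i, l.castSucc, true⟩ <;> cases h2 : u ⟨i, l.castSucc, false⟩ <;>
    cases h3 : u ⟨i, 0, false⟩ <;>
    simp [signPow, h1, h2, ht, hu.crossing] <;> field_simp <;> ring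

theorem edgeWeight_top {t : K} (ht : t ≠ 0) {u : PretzelEdge q → Bool} (hu : IsCoherent u)
    (i : Fin n) : edgeWeight t u ⟨finRotate n i, 0, false⟩ = - edgeWeight t u ⟨i, 0, true⟩ := by
  simp only [edgeWeight, hu.top]
  cases u ⟨i, 0, true⟩ <;> cases u ⟨i, 0, false⟩ <;> simp [signPow, ht]

theorem edgeWeight_bottom {t : K} (ht : t ≠ 0) {u : PretzelEdge q → Bool} (hu : IsCoherent u)
    (i : Fin n) :
    edgeWeight t u ⟨finRotate n i, Fin.last _, false⟩ = - edgeWeight t u ⟨i, Fin.last _, true⟩ := by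
  simp only [edgeWeight, hu.top, hu.bottom]
  rw [hu.eq_top i (Fin.last _) true, hu.eq_top i (Fin.last _) false]
  cases decide (Odd ((Fin.last (q i).natAbs : Fin _) : ℕ)) <;>
    simp only [Bool.xor_false, Bool.xor_true, Bool.not_true, Bool.not_false] <;>
    cases h1 : u ⟨i, 0, true⟩ <;> cases h2 : u ⟨i, 0, false⟩ <;> simp [signPow, ht, h1, h2]

theorem sum_crossing_ends (g : PretzelEdge q → K) (i : Fin n) (l : Fin (q i).natAbs) :
    ∑ k, (if pretzelBelow q (Sum.inl (⟨i, l⟩, k)) then g ((pretzel q).edge (Sum.inl (⟨i, l⟩, k)))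
      else - g ((pretzel q).edge (Sum.inl (⟨i, l⟩, k)))) =
    g ⟨i, l.succ, overSide q i⟩ + g ⟨i, l.succ, !overSide q i⟩
      - g ⟨i, l.castSucc, overSide q i⟩ - g ⟨i, l.castSucc, !overSide q i⟩ := by
  by_cases hq : 0 < q i <;>
    simp [Fin.sum_univ_four, pretzel, pretzelBelow, pretzelAtCrossing, overSide, hq] <;> ring

variable (f : ℤ[T;T⁻¹] →+* K)

theorem rowWeight_vecMul (o : (pretzel q).Orientation) :
    rowWeight (f (LaurentPolynomial.T 1)) (pretzelUp o) ᵥ* (o.alexanderMatrix.map f) = 0 := by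
  have ht := apply_T_one_ne_zero f
  have hu := isCoherent_pretzelUp o
  set t := f (LaurentPolynomial.T 1) with htdef
  set u := pretzelUp o with hudef
  have key : ∀ c, rowWeight t u ⬝ᵥ ((o.alexanderMatrix.map f) *ᵥ c) = 0 := by
    intro c
    rw [← sum_ends_eq_zero (fun e => edgeWeight t u e * c e)]
    simp only [dotProduct, Fintype.sum_sum_type, Fintype.sum_prod_type, ← add_assoc]
    rw [← Finset.sum_add_distrib]
    congr 1
    · refine Finset.sum_congr rfl fun ⟨i, l⟩ _ => ?_
      rw [sum_crossing_ends (fun e => edgeWeight t u e * c e), mulVec_crossing, mulVec_over]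
      have h0 := (isSignedPow_crossingFactor t u i l).ne_zero ht
      simp only [rowWeight, ← htdef, ← hudef]
      rw [edgeWeight_over ht hu, edgeWeight_under ht hu]
      field_simp
      ring
    · refine Finset.sum_congr rfl fun i _ => ?_
      simp only [Fintype.sum_bool, Fin.sum_univ_two, mulVec_top, mulVec_bottom, rowWeight]
      simp only [pretzel, pretzelBelow, pretzelAtJoint, Sum.elim_inr, if_true,
        Matrix.cons_val_zero, Matrix.cons_val_one, edgeWeight_top ht hu, edgeWeight_bottom ht hu,
        Bool.false_eq_true, if_false]
      ring
  ext e
  have h := key (Pi.single e 1)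
  rw [Matrix.dotProduct_mulVec, dotProduct_single, mul_one] at h
  exact h

end Dependency

/-! ### Colourings of the twist regions -/

section Colouring

variable {n : ℕ} {q : Fin n → ℤ} {K : Type*} [Field K]

/-- The edge matched with a row of the Alexander matrix, as a pivot of the elimination: a crossing
relation determines the colour of the lower strand below the crossing, an equality at a crossing
that of the upper strand below it, and an equality at a top joint that of the top right edge
of the twist region. The bottom joints are matched with the remaining edges, those at the top left. -/
def rowEdge (q : Fin n → ℤ) : AlexanderRow q → PretzelEdge q
  | Sum.inl ⟨i, l⟩ => ⟨i, l.succ, !overSide q i⟩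
  | Sum.inr (Sum.inl ⟨i, l⟩) => ⟨i, l.succ, overSide q i⟩
  | Sum.inr (Sum.inr (i, b)) => ⟨i, 0, b⟩

theorem rowEdge_bijective (q : Fin n → ℤ) : Function.Bijective (rowEdge q) := by
  constructor
  · rintro (⟨i, l⟩ | ⟨i, l⟩ | ⟨i, b⟩) (⟨i', l'⟩ | ⟨i', l'⟩ | ⟨i', b'⟩) h
    all_goals
      simp only [rowEdge, pretzelEdge_ext] at h
      obtain ⟨rfl, h1, h2⟩ := h
      simp at h1 h2
    · rw [Fin.ext h1]
    · rw [Fin.ext h1]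
    · rw [h2]
  · rintro ⟨i, l, b⟩
    induction l using Fin.cases with
    | zero => exact ⟨Sum.inr (Sum.inr (i, b)), rfl⟩
    | succ l =>
      by_cases hb : b = overSide q i
      · exact ⟨Sum.inr (Sum.inl ⟨i, l⟩), by rw [rowEdge, hb]⟩
      · exact ⟨Sum.inl ⟨i, l⟩, by rw [rowEdge, Bool.eq_not_of_ne hb]⟩

/-- The matching of rows and edges as an equivalence. -/
noncomputable def rowEquiv (q : Fin n → ℤ) :
    AlexanderRow q ≃ PretzelEdge q :=
  Equiv.ofBijective _ (rowEdge_bijective q)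

theorem rowEquiv_apply (q : Fin n → ℤ) (r : AlexanderRow q) :
    rowEquiv q r = rowEdge q r := rfl

/-- `crossingPow` at the level `k` of the twist region `i`, expressed by the directions of the top
edges and defined for all natural numbers `k`. -/
noncomputable def levelPow (t : K) (u : PretzelEdge q → Bool) (i : Fin n) (k : ℕ) : K :=
  signPow t (xor (u ⟨i, 0, xor (overSide q i) (decide (Odd (k + 1)))⟩) (overSide q i))

theorem IsCoherent.crossingPow_eq {u : PretzelEdge q → Bool} (hu : IsCoherent u) (t : K)
    (i : Fin n) (l : Fin (q i).natAbs) : crossingPow t u i l = levelPow t u i l := by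
  rw [crossingPow, levelPow, hu.eq_top]
  simp

/-- The difference of the colours of the right and the left edge at the level `l` of a twist region,
when it is `1` at the top. -/
noncomputable def twistDiff (t : K) (u : PretzelEdge q → Bool) (i : Fin n) (l : ℕ) : K :=
  ∏ k ∈ Finset.range l, (- levelPow t u i k)

/-- The colour of the left edge at the level `l` of a twist region, when the top edges have the
colours `0` (left) and `1` (right). -/
noncomputable def twistShift (t : K) (u : PretzelEdge q → Bool) (i : Fin n) (l : ℕ) : K :=
  ∑ k ∈ Finset.range l,
    if overSide q i then - twistDiff t u i (k + 1) else twistDiff t u i k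

/-- The colouring of the edges for which the top left edges have the prescribed colours `x`, and
which satisfies all equations except for those at the bottom joints. -/
noncomputable def twistColouring (t : K) (u : PretzelEdge q → Bool) (x : Fin n → K)
    (e : PretzelEdge q) : K :=
  x e.1 + (twistShift t u e.1 e.2.1 + if e.2.2 then twistDiff t u e.1 e.2.1 else 0) *
    (x (finRotate n e.1) - x e.1)

theorem twistColouring_topLeft (t : K) (u : PretzelEdge q → Bool) (x : Fin n → K) (i : Fin n) :
    twistColouring t u x ⟨i, 0, false⟩ = x i := by
  simp [twistColouring, twistShift]

theorem twistColouring_topRight (t : K) (u : PretzelEdge q → Bool) (x : Fin n → K) (i : Fin n) :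
    twistColouring t u x ⟨i, 0, true⟩ = x (finRotate n i) := by
  simp [twistColouring, twistShift, twistDiff]

theorem twistDiff_succ (t : K) (u : PretzelEdge q → Bool) (i : Fin n) (l : ℕ) :
    twistDiff t u i (l + 1) = twistDiff t u i l * - levelPow t u i l := by
  rw [twistDiff, Finset.prod_range_succ, ← twistDiff]

theorem twistShift_succ (t : K) (u : PretzelEdge q → Bool) (i : Fin n) (l : ℕ) :
    twistShift t u i (l + 1) = twistShift t u i l +
      if overSide q i then - twistDiff t u i (l + 1) else twistDiff t u i l := by
  rw [twistShift, Finset.sum_range_succ, ← twistShift]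

/-- The colour of the left edge at the bottom of a twist region, when the top edges have the
colours `0` (left) and `1` (right). -/
noncomputable def bottomLeft (t : K) (u : PretzelEdge q → Bool) (i : Fin n) : K :=
  twistShift t u i (q i).natAbs

/-- The colour of the right edge at the bottom of a twist region minus that of the right edge at the
top, when the top edges have the colours `0` (left) and `1` (right). -/
noncomputable def bottomRight (t : K) (u : PretzelEdge q → Bool) (i : Fin n) : K :=
  twistShift t u i (q i).natAbs + twistDiff t u i (q i).natAbs - 1

variable (f : ℤ[T;T⁻¹] →+* K) (o : (pretzel q).Orientation) (x : Fin n → K)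

theorem mulVec_crossing_twistColouring (i : Fin n) (l : Fin (q i).natAbs) :
    ((o.alexanderMatrix.map f) *ᵥ
      twistColouring (f (LaurentPolynomial.T 1)) (pretzelUp o) x) (Sum.inl ⟨i, l⟩) = 0 := by
  rw [mulVec_crossing, (isCoherent_pretzelUp o).crossingPow_eq]
  simp only [twistColouring, Fin.val_succ, Fin.val_castSucc, twistShift_succ, twistDiff_succ]
  cases overSide q i <;> simp <;> right <;> ring

theorem mulVec_over_twistColouring (i : Fin n) (l : Fin (q i).natAbs) :
    ((o.alexanderMatrix.map f) *ᵥ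
      twistColouring (f (LaurentPolynomial.T 1)) (pretzelUp o) x) (Sum.inr (Sum.inl ⟨i, l⟩)) = 0 := by
  rw [mulVec_over]
  simp only [twistColouring, Fin.val_succ, Fin.val_castSucc, twistShift_succ]
  cases overSide q i <;> simp

theorem mulVec_top_twistColouring (i : Fin n) :
    ((o.alexanderMatrix.map f) *ᵥ twistColouring (f (LaurentPolynomial.T 1)) (pretzelUp o) x)
      (Sum.inr (Sum.inr (i, true))) = 0 := by
  rw [mulVec_top, twistColouring_topLeft, twistColouring_topRight, sub_self]

theorem mulVec_bottom_twistColouring (i : Fin n) :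
    ((o.alexanderMatrix.map f) *ᵥ twistColouring (f (LaurentPolynomial.T 1)) (pretzelUp o) x)
      (Sum.inr (Sum.inr (i, false))) =
    bottomRight (f (LaurentPolynomial.T 1)) (pretzelUp o) i * (x (finRotate n i) - x i)
    - bottomLeft (f (LaurentPolynomial.T 1)) (pretzelUp o) (finRotate n i) *
      (x (finRotate n (finRotate n i)) - x (finRotate n i)) := by
  rw [mulVec_bottom]
  simp only [twistColouring, bottomLeft, bottomRight, Fin.val_last, if_true, Bool.false_eq_true,
    if_false]
  ring

end Colouring

/-! ### The minors of the Alexander matrix -/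

section Minors

variable {m : ℕ} {q : Fin (m + 1) → ℤ} {K : Type*} [Field K]

/-- The colours of the top left edges for which the difference `x (i + 1) - x i` is `1` for `i = k` and
`0` for all other `i < m`. -/
def stepVector (K : Type*) [Field K] (k : Fin (m + 1)) : Fin (m + 1) → K :=
  fun i => if i ≤ k then -1 else 0

/-- Whether a row of the Alexander matrix belongs to a bottom joint. -/
def isBottomJoint : AlexanderRow q → Bool
  | Sum.inr (Sum.inr (_, false)) => true
  | _ => false

/-- The change of variables that replaces the colours of the top left edges by
their differences and the colours of all other edges by their deviations from a colouring of the
twist regions. -/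
noncomputable def changeMatrix (t : K) (u : PretzelEdge q → Bool) :
    Matrix (AlexanderRow q) (AlexanderRow q) K :=
  Matrix.of fun r s => match s with
    | Sum.inr (Sum.inr (k, false)) => twistColouring t u (stepVector K k) (rowEdge q r)
    | s => if r = s then 1 else 0

theorem changeMatrix_of_isBottomJoint (t : K) (u : PretzelEdge q → Bool) (r)
    {s : AlexanderRow q}
    (hs : isBottomJoint s = false) : changeMatrix t u r s = if r = s then 1 else 0 := by
  rcases s with ⟨i, l⟩ | ⟨i, l⟩ | ⟨i, _ | _⟩
  · rfl
  · rfl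
  · cases hs
  · rfl

theorem isSignedPow_det_changeMatrix (t : K) (ht : t ≠ 0) (u : PretzelEdge q → Bool) :
    IsSignedPow t (changeMatrix t u).det := by
  rw [Matrix.det_eq_prod_diag_of_rank _ (fun r => match r with
    | Sum.inr (Sum.inr (k, false)) => m + 1 - k
    | _ => m + 2)]
  · refine IsSignedPow.prod ht _ fun r _ => ?_
    rcases r with ⟨i, l⟩ | ⟨i, l⟩ | ⟨i, _ | _⟩
    · rw [changeMatrix_of_isBottomJoint t u _ rfl, if_pos rfl]; exact IsSignedPow.one
    · rw [changeMatrix_of_isBottomJoint t u _ rfl, if_pos rfl]; exact IsSignedPow.one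
    · simp only [changeMatrix, Matrix.of_apply, rowEdge, twistColouring_topLeft, stepVector,
        le_refl, if_true]
      exact IsSignedPow.one.neg
    · rw [changeMatrix_of_isBottomJoint t u _ rfl, if_pos rfl]; exact IsSignedPow.one
  · intro r s h
    rcases hs : isBottomJoint s
    · rw [changeMatrix_of_isBottomJoint t u _ hs] at h
      left
      by_contra hrs
      exact h (if_neg hrs)
    · rcases s with ⟨k, l⟩ | ⟨k, l⟩ | ⟨k, _ | _⟩
      · cases hs
      · cases hs
      · rcases r with ⟨i, l⟩ | ⟨i, l⟩ | ⟨i, _ | _⟩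
        · right; simp only; omega
        · right; simp only; omega
        · simp only [changeMatrix, Matrix.of_apply, rowEdge, twistColouring_topLeft,
            stepVector] at h
          have hik : i ≤ k := by
            by_contra hik
            exact h (if_neg hik)
          rcases hik.eq_or_lt with rfl | hlt
          · exact Or.inl rfl
          · right
            have : (i : ℕ) < k := hlt
            have := k.2
            simp only
            omega
        · right; simp only; omega
      · cases hs

variable (f : ℤ[T;T⁻¹] →+* K) (o : (pretzel q).Orientation)

/-- The equations at the crossings and top joints form a triangular system for the colours of all
edges except for the top left ones. -/
theorem isSignedPow_det_block (B : Matrix (AlexanderRow q) (AlexanderRow q) K)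
    (hB : ∀ r s, isBottomJoint r = false → isBottomJoint s = false →
      B r s = o.alexanderMatrix.map f r (rowEdge q s)) :
    IsSignedPow (f (LaurentPolynomial.T 1))
      (B.toSquareBlockProp (fun r => isBottomJoint r = false)).det := by
  have ht := apply_T_one_ne_zero f
  have hB' : ∀ r s : {r : AlexanderRow q //
      isBottomJoint r = false}, B.toSquareBlockProp (fun r => isBottomJoint r = false) r s
      = ((o.alexanderMatrix.map f) *ᵥ Pi.single (rowEdge q s) 1) r := by
    intro r s
    rw [Matrix.mulVec_single_one, Matrix.col_apply]
    exact hB r s r.2 s.2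
  -- edges are ranked from top to bottom, on each level the upper strand of the crossing above first
  let rank : PretzelEdge q → ℕ := fun e => 2 * (e.2.1 : ℕ) + if e.2.2 = overSide q e.1 then 0 else 1
  rw [Matrix.det_eq_prod_diag_of_rank _
    (fun r : {r // isBottomJoint r = false} => rank (rowEdge q r))]
  · refine IsSignedPow.prod ht _ ?_
    rintro ⟨⟨i, l⟩ | ⟨i, l⟩ | ⟨i, _ | _⟩, hr⟩ -
    · rw [hB', mulVec_crossing]
      refine (isSignedPow_crossingFactor _ _ i l).mul ht ?_
      simp [rowEdge, -Sigma.mk.injEq, pretzelEdge_ext, IsSignedPow.one.neg]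
    · rw [hB', mulVec_over]
      simp [rowEdge, -Sigma.mk.injEq, pretzelEdge_ext, IsSignedPow.one]
    · cases hr
    · rw [hB', mulVec_top]
      simp [rowEdge, -Sigma.mk.injEq, pretzelEdge_ext, IsSignedPow.one]
  · rintro ⟨r, hr⟩ ⟨s, hs⟩ h
    rw [hB'] at h
    simp only [Subtype.mk.injEq]
    rw [← (rowEdge_bijective q).1.eq_iff]
    generalize he : rowEdge q s = e at h ⊢
    rcases r with ⟨i, l⟩ | ⟨i, l⟩ | ⟨i, _ | _⟩
    · rw [mulVec_crossing] at h
      by_cases h1 : (⟨i, l.succ, overSide q i⟩ : PretzelEdge q) = e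
      · right; subst h1; simp [rank, rowEdge]
      by_cases h2 : (⟨i, l.castSucc, overSide q i⟩ : PretzelEdge q) = e
      · right; subst h2; simp [rank, rowEdge]
      by_cases h3 : (⟨i, l.succ, !overSide q i⟩ : PretzelEdge q) = e
      · left; exact h3
      · simp [h1, h2, h3, -Sigma.mk.injEq] at h
    · rw [mulVec_over] at h
      by_cases h1 : (⟨i, l.succ, overSide q i⟩ : PretzelEdge q) = e
      · left; exact h1
      by_cases h2 : (⟨i, l.castSucc, !overSide q i⟩ : PretzelEdge q) = e
      · right; subst h2; simp [rank, rowEdge]; omega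
      · simp [h1, h2, -Sigma.mk.injEq] at h
    · cases hr
    · rw [mulVec_top] at h
      by_cases h1 : (⟨i, 0, true⟩ : PretzelEdge q) = e
      · left; exact h1
      by_cases h2 : (⟨finRotate (m + 1) i, 0, false⟩ : PretzelEdge q) = e
      · have : s = Sum.inr (Sum.inr (finRotate (m + 1) i, false)) :=
          (rowEdge_bijective q).1 (he.trans h2.symm)
        rw [this] at hs
        cases hs
      · simp [h1, h2, -Sigma.mk.injEq] at h

/-- The rows of the bottom joints, enumerated by the twist regions. -/
def bottomJointEquiv : Fin (m + 1) ≃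
    {r : AlexanderRow q // ¬ isBottomJoint r = false} where
  toFun i := ⟨Sum.inr (Sum.inr (i, false)), by simp [isBottomJoint]⟩
  invFun r := match r with
    | ⟨Sum.inr (Sum.inr (i, _)), _⟩ => i
    | _ => 0
  left_inv i := rfl
  right_inv := by
    rintro ⟨⟨i, l⟩ | ⟨i, l⟩ | ⟨i, _ | _⟩, hr⟩ <;> first | rfl | exact absurd rfl hr

theorem stepVector_sub {i : Fin (m + 1)} (hi : i ≠ Fin.last m) (k : Fin (m + 1)) :
    stepVector K k (finRotate (m + 1) i) - stepVector K k i = if (k : ℕ) = i then 1 else 0 := by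
  obtain ⟨i, rfl⟩ := Fin.exists_castSucc_eq.2 hi
  have h : finRotate (m + 1) i.castSucc = i.succ := by
    ext; simp
  simp only [stepVector, h, Fin.le_def, Fin.val_succ, Fin.val_castSucc]
  split_ifs <;> first | omega | simp

theorem stepVector_sub_last (k : Fin (m + 1)) :
    stepVector K k (finRotate (m + 1) (Fin.last m)) - stepVector K k (Fin.last m)
      = -1 + if (k : ℕ) = m then 1 else 0 := by
  have h : finRotate (m + 1) (Fin.last m) = 0 := by
    simp
  have := k.2
  simp only [stepVector, h, Fin.le_def, Fin.val_zero, Fin.val_last]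
  split_ifs <;> first | omega | simp

/-- One minor of the Alexander matrix, that of a bottom joint and a top left edge, is the chain sum
up to sign and a power of `t`. -/
theorem exists_adjugate_eq_chainSum : ∃ η, IsSignedPow (f (LaurentPolynomial.T 1)) η ∧
    ((o.alexanderMatrix.map f).submatrix id (rowEquiv q)).adjugate
      (Sum.inr (Sum.inr (0, false))) (Sum.inr (Sum.inr (Fin.last m, false))) =
    η * chainSum (bottomLeft (f (LaurentPolynomial.T 1)) (pretzelUp o))
      (bottomRight (f (LaurentPolynomial.T 1)) (pretzelUp o)) := by
  have ht := apply_T_one_ne_zero f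
  set t := f (LaurentPolynomial.T 1) with htdef
  set u := pretzelUp o with hudef
  set α := bottomLeft t u
  set γ := bottomRight t u
  let r₀ : AlexanderRow q :=
    Sum.inr (Sum.inr (Fin.last m, false))
  let B := (o.alexanderMatrix.map f).submatrix id (rowEquiv q)
  let B' := B.updateRow r₀ (Pi.single (Sum.inr (Sum.inr (0, false))) 1)
  let C := B' * changeMatrix t u
  have hC : ∀ r s, r ≠ r₀ → C r s = ((o.alexanderMatrix.map f) *ᵥ
      (fun e => changeMatrix t u ((rowEquiv q).symm e) s)) r := by
    intro r s hr
    simp only [C, Matrix.mul_apply, Matrix.mulVec, dotProduct, B', Matrix.updateRow_ne hr, B,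
      Matrix.submatrix_apply, id]
    rw [← Equiv.sum_comp (rowEquiv q)]
    simp
  have hC0 : ∀ r s, r ≠ r₀ → isBottomJoint s = false →
      C r s = o.alexanderMatrix.map f r (rowEdge q s) := by
    intro r s hr hs
    simp only [C, Matrix.mul_apply, changeMatrix_of_isBottomJoint t u _ hs, mul_ite, mul_one,
      mul_zero, Finset.sum_ite_eq', Finset.mem_univ, if_true, B', Matrix.updateRow_ne hr]
    rfl
  have hC1 : ∀ r k, r ≠ r₀ → C r (Sum.inr (Sum.inr (k, false))) =
      ((o.alexanderMatrix.map f) *ᵥ twistColouring t u (stepVector K k)) r := by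
    intro r k hr
    rw [hC r _ hr]
    congr 2
    ext e
    simp only [changeMatrix, Matrix.of_apply]
    rw [← rowEquiv_apply, Equiv.apply_symm_apply]
  have hC2 : ∀ k, C r₀ (Sum.inr (Sum.inr (k, false))) = -1 := by
    intro k
    simp only [C, Matrix.mul_apply, B', Matrix.updateRow_self]
    rw [Finset.sum_eq_single (Sum.inr (Sum.inr (0, false)))]
    · simp [changeMatrix, rowEdge, twistColouring_topLeft, stepVector]
    · intro b _ hb
      rw [Pi.single_eq_of_ne hb, zero_mul]
    · simp
  have hdet : C.det = (C.toSquareBlockProp (fun r => isBottomJoint r = false)).det *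
      (C.toSquareBlockProp (fun r => ¬ isBottomJoint r = false)).det := by
    refine Matrix.twoBlockTriangular_det' _ _ ?_
    intro r hr s hs
    rw [Bool.not_eq_false] at hs
    have hr₀ : r ≠ r₀ := by
      rintro rfl
      cases hr
    rcases s with ⟨k, l⟩ | ⟨k, l⟩ | ⟨k, _ | _⟩
    · cases hs
    · cases hs
    · rw [hC1 r k hr₀]
      rcases r with ⟨i, l⟩ | ⟨i, l⟩ | ⟨i, _ | _⟩
      · exact mulVec_crossing_twistColouring f o _ i l
      · exact mulVec_over_twistColouring f o _ i l
      · cases hr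
      · exact mulVec_top_twistColouring f o _ i
    · cases hs
  have hblock : IsSignedPow t (C.toSquareBlockProp (fun r => isBottomJoint r = false)).det := by
    refine isSignedPow_det_block f o C fun r s hr hs => hC0 r s ?_ hs
    rintro rfl
    cases hr
  have hchain : (C.toSquareBlockProp (fun r => ¬ isBottomJoint r = false)).det
      = - chainSum α γ := by
    rw [← det_chainMatrix, ← Matrix.det_submatrix_equiv_self bottomJointEquiv]
    -- the last difference, `x 0 - x m`, is `-∑ i < m, d i`; a multiple of the last row accounts for it
    refine Matrix.det_eq_of_forall_row_eq_smul_add_const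
      (fun i => if (i : ℕ) + 1 = m then - α (Fin.last m) else 0) (Fin.last m) (by simp) ?_
    intro i k
    by_cases hi : i = Fin.last m
    · subst hi
      exact (hC2 k).trans (by simp [chainMatrix])
    · have hlhs : (C.toSquareBlockProp (fun r => ¬ isBottomJoint r = false)).submatrix
          bottomJointEquiv bottomJointEquiv i k = ((o.alexanderMatrix.map f) *ᵥ
            twistColouring t u (stepVector K k)) (Sum.inr (Sum.inr (i, false))) := by
        refine hC1 _ k ?_
        intro h
        exact hi (by simpa [r₀, bottomJointEquiv] using h)
      rw [hlhs, mulVec_bottom_twistColouring, stepVector_sub hi]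
      simp only [chainMatrix, Matrix.of_apply, hi, if_false, if_true]
      have hrot : (finRotate (m + 1) i : ℕ) = i + 1 := by
        obtain ⟨i, rfl⟩ := Fin.exists_castSucc_eq.2 hi
        simp
      by_cases hi' : finRotate (m + 1) i = Fin.last m
      · have him : (i : ℕ) + 1 = m := by
          rw [← hrot, hi', Fin.val_last]
        rw [hi', stepVector_sub_last, if_pos him]
        simp only [him]
        by_cases hk : (k : ℕ) = m
        · have : k = Fin.last m := Fin.ext hk
          subst this
          have h2 : m ≠ i := by omega
          simp only [Fin.val_last, h2, if_false, if_true]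
          ring
        · simp only [hk, if_false]
          by_cases hki : (k : ℕ) = i
          · have : k = i := Fin.ext hki
            subst this
            simp [γ, α, u, t]
          · simp [hki, α, u, t]
      · rw [stepVector_sub hi']
        have him : (i : ℕ) + 1 ≠ m := fun h => hi' (Fin.ext (by rw [hrot, h, Fin.val_last]))
        rw [if_neg him, hrot]
        by_cases hki : (k : ℕ) = i
        · have : k = i := Fin.ext hki
          subst this
          simp [γ, u, t]
        · by_cases hk : (k : ℕ) = i + 1
          · have : k = finRotate (m + 1) i := Fin.ext (hk.trans hrot.symm)
            rw [← this]
            simp [hk, α, u, t]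
          · simp [hki, hk]
  have hQ := isSignedPow_det_changeMatrix t ht u
  refine ⟨- (C.toSquareBlockProp (fun r => isBottomJoint r = false)).det / (changeMatrix t u).det,
    hblock.neg.div ht hQ, ?_⟩
  rw [Matrix.adjugate_apply]
  have h1 : C.det = B'.det * (changeMatrix t u).det := Matrix.det_mul _ _
  have h2 : B'.det = C.det / (changeMatrix t u).det := by
    rw [h1, mul_div_cancel_right₀ _ (hQ.ne_zero ht)]
  change B'.det = _
  rw [h2, hdet, hchain]
  ring

/-- Every minor of the Alexander matrix is the chain sum, up to sign and a power of `t`. -/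
theorem exists_minor_eq_chainSum {Δ : ℤ[T;T⁻¹]} (hΔ : (pretzel q).IsAlexanderPolynomial Δ) :
    ∃ (o : (pretzel q).Orientation) (η : K), IsSignedPow (f (LaurentPolynomial.T 1)) η ∧
      f Δ = η * chainSum (bottomLeft (f (LaurentPolynomial.T 1)) (pretzelUp o))
        (bottomRight (f (LaurentPolynomial.T 1)) (pretzelUp o)) := by
  obtain ⟨o, r, c, σ, rfl⟩ := hΔ
  have ht := apply_T_one_ne_zero f
  obtain ⟨η, hη, h⟩ := exists_adjugate_eq_chainSum f o
  obtain ⟨ε, hε⟩ := Matrix.det_submatrix_ne_eq_adjugate (o.alexanderMatrix.map f) (rowEquiv q) r c σ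
  set t := f (LaurentPolynomial.T 1) with htdef
  let B := (o.alexanderMatrix.map f).submatrix id (rowEquiv q)
  have hB1 : B *ᵥ (fun _ => 1) = 0 := by
    ext i
    have := congrFun (mulVec_one f o) i
    simp only [Matrix.mulVec, dotProduct, B, Matrix.submatrix_apply, id] at this ⊢
    rw [Equiv.sum_comp (rowEquiv q) (fun e => o.alexanderMatrix.map f i e * 1)]
    exact this
  have hB2 : rowWeight t (pretzelUp o) ᵥ* B = 0 := by
    ext s
    exact congrFun (rowWeight_vecMul f o) (rowEquiv q s)
  have h1 := Matrix.adjugate_eq_of_mulVec_one B hB1 ((rowEquiv q).symm c)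
    (Sum.inr (Sum.inr (0, false))) r
  have h2 := Matrix.mul_adjugate_eq_of_vecMul B _ hB2 (Sum.inr (Sum.inr (0, false))) r
    (Sum.inr (Sum.inr (Fin.last m, false)))
  have hw := isSignedPow_rowWeight ht (pretzelUp o)
  have h3 := (hw (Sum.inr (Sum.inr (Fin.last m, false)))).ne_zero ht
  have hε' : IsSignedPow t ((ε : ℤ) : K) := by
    rcases Int.units_eq_one_or ε with rfl | rfl
    · simpa using IsSignedPow.one
    · simpa using IsSignedPow.one.neg
  refine ⟨o, (ε : ℤ) * (rowWeight t (pretzelUp o) r /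
    rowWeight t (pretzelUp o) (Sum.inr (Sum.inr (Fin.last m, false))) * η),
    hε'.mul ht (((hw _).div ht (hw _)).mul ht hη), ?_⟩
  have h4 : f (o.alexanderMatrix.submatrix
      (fun i : {r' // r' ≠ r} => (i : AlexanderRow q))
      (fun i => (σ i : PretzelEdge q))).det = ((o.alexanderMatrix.map f).submatrix
      (fun i : {r' // r' ≠ r} => (i : AlexanderRow q))
      (fun i => (σ i : PretzelEdge q))).det := by
    rw [RingHom.map_det]
    rfl
  rw [h4, hε, h1]
  change _ * B.adjugate _ _ = _
  change B.adjugate _ _ = _ at h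
  rw [h] at h2
  field_simp
  linear_combination (ε : K) * h2

end Minors

/-! ### The colours at the bottom of a twist region -/

section ClosedForms

variable {n : ℕ} {q : Fin n → ℤ} {K : Type*} [Field K] {t : K} {u : PretzelEdge q → Bool}
  {i : Fin n}

theorem signPow_not (t : K) (b : Bool) : signPow t (!b) = (signPow t b)⁻¹ := by
  cases b <;> simp [signPow]

theorem levelPow_of_eq (h : u ⟨i, 0, false⟩ = u ⟨i, 0, true⟩) (k : ℕ) :
    levelPow t u i k = signPow t (xor (u ⟨i, 0, true⟩) (overSide q i)) := by
  rw [levelPow]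
  cases xor (overSide q i) (decide (Odd (k + 1))) <;> simp [h]

theorem natAbs_eq_of_overSide_false (h : overSide q i = false) : ((q i).natAbs : ℤ) = q i := by
  simp only [overSide, Bool.not_eq_false', decide_eq_true_eq] at h
  omega

theorem natAbs_eq_of_overSide_true (h : overSide q i = true) : ((q i).natAbs : ℤ) = - q i := by
  simp only [overSide, Bool.not_eq_true', decide_eq_false_iff_not] at h
  omega

theorem twistDiff_of_eq (h : u ⟨i, 0, false⟩ = u ⟨i, 0, true⟩) :
    twistDiff t u i (q i).natAbs = (- signPow t (u ⟨i, 0, true⟩)) ^ q i := by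
  simp only [twistDiff, levelPow_of_eq h, Finset.prod_const, Finset.card_range]
  rcases ho : overSide q i
  · rw [Bool.xor_false, ← zpow_natCast, natAbs_eq_of_overSide_false ho]
  · rw [Bool.xor_true, signPow_not, ← zpow_natCast, natAbs_eq_of_overSide_true ho, ← inv_neg,
      inv_zpow', neg_neg]

theorem bottomLeft_of_eq (ht : t ≠ 0) (h : u ⟨i, 0, false⟩ = u ⟨i, 0, true⟩) :
    bottomLeft t u i * (1 + signPow t (u ⟨i, 0, true⟩)) =
      1 - (- signPow t (u ⟨i, 0, true⟩)) ^ q i := by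
  set s := signPow t (xor (u ⟨i, 0, true⟩) (overSide q i)) with hs
  have hD : ∀ l, twistDiff t u i l = (-s) ^ l := by
    intro l
    simp [twistDiff, levelPow_of_eq h, hs]
  have hA : ∀ l, twistShift t u i l * (1 + s) =
      (if overSide q i then s else 1) * (1 - (-s) ^ l) := by
    intro l
    induction l with
    | zero => simp [twistShift]
    | succ l ih =>
      rw [twistShift_succ, add_mul, ih, hD, hD]
      cases overSide q i <;> simp <;> ring
  have hw := signPow_ne_zero ht (u ⟨i, 0, true⟩)
  have hA' := hA (q i).natAbs
  rw [← twistDiff_of_eq h, hD, bottomLeft]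
  rcases ho : overSide q i
  · simp only [ho, Bool.xor_false, Bool.false_eq_true, if_false, one_mul] at hs hA'
    rw [hs] at hA' ⊢
    exact hA'
  · simp only [ho, Bool.xor_true, signPow_not, if_true] at hs hA'
    rw [hs] at hA' ⊢
    field_simp at hA'
    linear_combination hA'

theorem bottomRight_of_eq (ht : t ≠ 0) (h : u ⟨i, 0, false⟩ = u ⟨i, 0, true⟩)
    (hw : 1 + signPow t (u ⟨i, 0, true⟩) ≠ 0) :
    bottomRight t u i = - signPow t (u ⟨i, 0, true⟩) * bottomLeft t u i := by
  have hα := bottomLeft_of_eq ht h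
  refine mul_right_cancel₀ hw ?_
  rw [bottomRight, ← bottomLeft, twistDiff_of_eq h]
  linear_combination (1 + signPow t (u ⟨i, 0, true⟩)) * hα

theorem levelPow_of_ne (h : u ⟨i, 0, false⟩ = !u ⟨i, 0, true⟩) (k : ℕ) :
    levelPow t u i k = if Odd k then (signPow t (u ⟨i, 0, true⟩))⁻¹
      else signPow t (u ⟨i, 0, true⟩) := by
  rw [levelPow]
  by_cases hk : Odd k <;> cases overSide q i <;> simp [hk, Nat.odd_add_one, h, signPow_not]

theorem twistDiff_of_ne (ht : t ≠ 0) (h : u ⟨i, 0, false⟩ = !u ⟨i, 0, true⟩) (l : ℕ) :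
    twistDiff t u i l = if Odd l then - signPow t (u ⟨i, 0, true⟩) else 1 := by
  have hw := signPow_ne_zero ht (u ⟨i, 0, true⟩)
  induction l with
  | zero => simp [twistDiff]
  | succ l ih =>
    rw [twistDiff_succ, ih, levelPow_of_ne h]
    by_cases hl : Odd l <;> simp [hl, Nat.odd_add_one, hw]

theorem two_mul_bottomLeft_of_ne (ht : t ≠ 0) (h : u ⟨i, 0, false⟩ = !u ⟨i, 0, true⟩) :
    2 * bottomLeft t u i = q i * (1 - signPow t (u ⟨i, 0, true⟩)) +
      if Odd (q i) then 1 + signPow t (u ⟨i, 0, true⟩) else 0 := by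
  have hA : ∀ l : ℕ, 2 * twistShift t u i l =
      (if overSide q i then -1 else 1) * l * (1 - signPow t (u ⟨i, 0, true⟩)) +
      if Odd l then 1 + signPow t (u ⟨i, 0, true⟩) else 0 := by
    intro l
    induction l with
    | zero => simp [twistShift]
    | succ l ih =>
      rw [twistShift_succ, mul_add, ih, twistDiff_of_ne ht h, twistDiff_of_ne ht h]
      by_cases hl : Odd l <;> cases overSide q i <;> simp [hl, Nat.odd_add_one] <;> ring
  rw [bottomLeft, hA]
  congr 2
  · rcases ho : overSide q i
    · simpa using congrArg (Int.cast : ℤ → K) (natAbs_eq_of_overSide_false ho)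
    · have := congrArg (Int.cast : ℤ → K) (natAbs_eq_of_overSide_true ho)
      simp at this ⊢
      rw [this, neg_neg]
  · simp [Int.natAbs_odd]

theorem bottomRight_of_ne_of_even (ht : t ≠ 0) (h : u ⟨i, 0, false⟩ = !u ⟨i, 0, true⟩)
    (hq : Even (q i)) : bottomRight t u i = bottomLeft t u i := by
  have : ¬ Odd (q i).natAbs := by rwa [Int.natAbs_odd, Int.not_odd_iff_even]
  rw [bottomRight, ← bottomLeft, twistDiff_of_ne ht h, if_neg this, add_sub_cancel_right]

theorem bottomLeft_sub_bottomRight_of_ne_of_odd (ht : t ≠ 0)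
    (h : u ⟨i, 0, false⟩ = !u ⟨i, 0, true⟩) (hq : Odd (q i)) :
    bottomLeft t u i - bottomRight t u i = 1 + signPow t (u ⟨i, 0, true⟩) := by
  rw [bottomRight, ← bottomLeft, twistDiff_of_ne ht h, if_pos (Int.natAbs_odd.2 hq)]
  ring

end ClosedForms

/-! ### Orientations of pretzel knots -/

section Orientations

variable {m : ℕ} {q : Fin (m + 1) → ℤ}

open Fin.NatCast in
theorem finRotate_induction {P : Fin (m + 1) → Prop} (j : Fin (m + 1)) (hj : P j)
    (h : ∀ i, P i → P (finRotate (m + 1) i)) (i : Fin (m + 1)) : P i := by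
  have key : ∀ k : ℕ, P (j + ((k : ℕ) : Fin (m + 1))) := by
    intro k
    induction k with
    | zero => simpa using hj
    | succ k ih =>
      have := h _ ih
      rw [finRotate_apply, add_assoc] at this
      simpa using this
  have := key ((i - j : Fin (m + 1)) : ℕ)
  simpa using this

theorem IsCoherent.bottom_of_odd {u : PretzelEdge q → Bool} (hu : IsCoherent u)
    {i : Fin (m + 1)} (hi : Odd (q i)) (b : Bool) : u ⟨i, Fin.last _, b⟩ = u ⟨i, 0, !b⟩ := by
  rw [hu.eq_top, Fin.val_last, decide_eq_true (Int.natAbs_odd.2 hi), Bool.xor_true]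

theorem IsCoherent.bottom_of_even {u : PretzelEdge q → Bool} (hu : IsCoherent u)
    {i : Fin (m + 1)} (hi : Even (q i)) (b : Bool) : u ⟨i, Fin.last _, b⟩ = u ⟨i, 0, b⟩ := by
  rw [hu.eq_top, Fin.val_last, decide_eq_false, Bool.xor_false]
  rwa [Int.natAbs_odd, Int.not_odd_iff_even]

/-- Both strands at the top of a twist region run in the same direction if exactly one of
the numbers of crossings is even, and that of the twist region is not. -/
theorem IsCoherent.eq_of_ne {u : PretzelEdge q → Bool} (hu : IsCoherent u) {j : Fin (m + 1)}
    (hj : Even (q j)) (hq : ∀ i, i ≠ j → Odd (q i)) (i : Fin (m + 1)) (hij : i ≠ j) :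
    u ⟨i, 0, false⟩ = u ⟨i, 0, true⟩ := by
  refine (finRotate_induction (P := fun i => i = j ∨ u ⟨i, 0, false⟩ = u ⟨i, 0, true⟩) j
    (Or.inl rfl) ?_ i).resolve_left hij
  intro i hi
  by_cases hr : finRotate (m + 1) i = j
  · exact Or.inl hr
  right
  have h1 := hu.top i
  have h2 := hu.bottom i
  rw [hu.bottom_of_odd (hq _ hr), Bool.not_false] at h2
  rw [h1, h2]
  by_cases hij : i = j
  · subst hij
    rw [hu.bottom_of_even hj]
  · rw [hu.bottom_of_odd (hq i hij), Bool.not_true, hi.resolve_left hij]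

/-- The top joints connect as many edges that run upwards as edges that run downwards. -/
theorem IsCoherent.sum_top {u : PretzelEdge q → Bool} (hu : IsCoherent u) :
    ∑ i, ((u ⟨i, 0, false⟩).toNat + (u ⟨i, 0, true⟩).toNat) = m + 1 := by
  rw [Finset.sum_add_distrib, ← Equiv.sum_comp (finRotate (m + 1)), ← Finset.sum_add_distrib]
  have : ∀ i, (u ⟨finRotate (m + 1) i, 0, false⟩).toNat + (u ⟨i, 0, true⟩).toNat = 1 := by
    intro i
    rw [hu.top]
    cases u ⟨i, 0, true⟩ <;> rfl
  simp [this, -finRotate_apply]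

theorem IsCoherent.sum_erase {u : PretzelEdge q → Bool} (hu : IsCoherent u) {j : Fin (m + 1)}
    (hj : Even (q j)) (hq : ∀ i, i ≠ j → Odd (q i)) :
    2 * ∑ i ∈ Finset.univ.erase j, (u ⟨i, 0, true⟩).toNat + (u ⟨j, 0, false⟩).toNat
      + (u ⟨j, 0, true⟩).toNat = m + 1 := by
  refine Eq.trans ?_ hu.sum_top
  rw [← Finset.sum_erase_add _ _ (Finset.mem_univ j), add_assoc, Finset.mul_sum]
  congr 1
  refine Finset.sum_congr rfl fun i hi => ?_
  rw [hu.eq_of_ne hj hq i (Finset.ne_of_mem_erase hi), two_mul]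

/-- If all numbers of crossings and the number of twist regions are odd, then the two strands of each
twist region run in opposite directions. -/
theorem IsCoherent.ne_of_odd {u : PretzelEdge q → Bool} (hu : IsCoherent u) (hm : Odd (m + 1))
    (hq : ∀ i, Odd (q i)) (i : Fin (m + 1)) : u ⟨i, 0, false⟩ = !u ⟨i, 0, true⟩ := by
  by_contra h
  have h' : u ⟨i, 0, false⟩ = u ⟨i, 0, true⟩ := by simpa using h
  have hall : ∀ i, u ⟨i, 0, false⟩ = u ⟨i, 0, true⟩ := by
    refine finRotate_induction i h' fun i hi => ?_
    have h2 := hu.bottom i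
    rw [hu.bottom_of_odd (hq _), hu.bottom_of_odd (hq _), Bool.not_false, Bool.not_true, hi] at h2
    rw [hu.top, h2]
  have hs := hu.sum_top
  simp only [hall, ← two_mul, ← Finset.mul_sum] at hs
  rw [← hs] at hm
  exact (Nat.not_odd_iff_even.2 (even_two_mul _)) hm

theorem IsCoherent.eq_zero_of_odd {u : PretzelEdge q → Bool} (hu : IsCoherent u)
    (hm : Odd (m + 1)) (hq : ∀ i, Odd (q i)) (i : Fin (m + 1)) :
    u ⟨i, 0, true⟩ = u ⟨0, 0, true⟩ := by
  refine finRotate_induction (P := fun i => u ⟨i, 0, true⟩ = u ⟨0, 0, true⟩) 0 rfl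
    (fun i hi => ?_) i
  rw [← hi, ← Bool.not_inj_iff, ← hu.ne_of_odd hm hq, hu.top]

theorem isCoherent_of_top (top : Fin (m + 1) → Bool → Bool)
    (h1 : ∀ i, top (finRotate (m + 1) i) false = !top i true)
    (h2 : ∀ i, top (finRotate (m + 1) i) (decide (Odd (q (finRotate (m + 1) i)))) =
      !top i (!decide (Odd (q i)))) :
    IsCoherent (q := q) (fun e => top e.1 (xor e.2.2 (decide (Odd (e.2.1 : ℕ))))) where
  crossing i l b := by
    by_cases hl : Odd (l : ℕ) <;> cases b <;> simp [hl, Nat.odd_add_one]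
  top i := by simpa using h1 i
  bottom i := by simpa [Int.natAbs_odd] using h2 i

theorem nonempty_orientation_of_odd (hq : ∀ i, Odd (q i)) : Nonempty (pretzel q).Orientation := by
  refine (isCoherent_of_top (q := q) (fun _ b => b) ?_ ?_).nonempty_orientation
  · simp
  · simp [hq]

/-- Going around from the twist region `j`, the twist regions are directed alternately. -/
theorem nonempty_orientation_of_even {j : Fin (m + 1)} (hj : Even (q j))
    (hq : ∀ i, i ≠ j → Odd (q i)) : Nonempty (pretzel q).Orientation := by
  have hr : ∀ i, finRotate (m + 1) i = j → ((i - j : Fin (m + 1)) : ℕ) = m := by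
    rintro i rfl
    rw [finRotate_apply, sub_add_cancel_left]
    simp
  have hr' : ∀ i, finRotate (m + 1) i ≠ j →
      ((finRotate (m + 1) i - j : Fin (m + 1)) : ℕ) = ((i - j : Fin (m + 1)) : ℕ) + 1 := by
    intro i hi
    rw [finRotate_apply] at hi ⊢
    rw [add_sub_right_comm, Fin.val_add_one, if_neg]
    intro h
    apply hi
    rw [← sub_eq_zero, add_sub_right_comm, h]
    simp
  have hpar : ∀ k : ℕ, decide (Odd (k + 1)) = !decide (Odd k) := by
    intro k
    by_cases hk : Odd k <;> simp [hk, Nat.odd_add_one]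
  refine (isCoherent_of_top (q := q) (fun i b => if i = j ∧ b = false then decide (Odd (m + 1))
    else decide (Odd ((i - j : Fin (m + 1)) : ℕ))) ?_ ?_).nonempty_orientation
  · intro i
    by_cases hi : finRotate (m + 1) i = j
    · simp [-finRotate_apply, hi, hr i hi, hpar]
    · simp [-finRotate_apply, hi, hr' i hi, hpar]
  · intro i
    have hjn : ¬ Odd (q j) := Int.not_odd_iff_even.2 hj
    by_cases hi : finRotate (m + 1) i = j <;> by_cases hij : i = j
    · have := hr i hi
      subst hij
      simp [-finRotate_apply, hi, hjn, hpar] at this ⊢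
      simp [← this]
    · simp [-finRotate_apply, hi, hij, hq i hij, hjn, hr i hi, hpar]
    · subst hij
      simp [-finRotate_apply, hi, hjn, hr' i hi]
    · simp [-finRotate_apply, hi, hij, hr' i hi, hpar]

theorem exists_isAlexanderPolynomial (h : Nonempty (pretzel q).Orientation) :
    ∃ Δ, (pretzel q).IsAlexanderPolynomial Δ := by
  obtain ⟨o⟩ := h
  let r : AlexanderRow q :=
    Sum.inr (Sum.inr (0, false))
  exact ⟨_, o, r, rowEquiv q r,
    (rowEquiv q).subtypeEquiv fun a => by simp, rfl⟩

end Orientations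

/-! ### Evaluation of the chain sum -/

section ChainSum

theorem mul_chainSum_of_sub_eq {R : Type*} [CommRing R] {m : ℕ} (α γ : Fin m → R) (c : R)
    (h : ∀ i, α i - γ i = c) : c * chainSum α γ = ∏ i, α i - ∏ i, γ i := by
  induction m with
  | zero => simp [chainSum]
  | succ m ih =>
    rw [chainSum_succ, Fin.prod_univ_succ, Fin.prod_univ_succ]
    have := ih (fun k => α k.succ) (fun k => γ k.succ) fun i => h _
    linear_combination γ 0 * this - (∏ k : Fin m, α k.succ) * h 0

/-- If `γ i = ρ i * α i`, the terms of the chain sum are the products of all but one of the `α i`, with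
coefficients `∏ k < i, ρ k = φ i / φ 0`. -/
theorem mul_chainSum_of_eq_mul {R : Type*} [CommRing R] {m : ℕ} (α γ ρ φ : Fin (m + 1) → R)
    (hγ : ∀ i, γ i = ρ i * α i) (hφ : ∀ i : Fin m, φ i.succ = ρ i.castSucc * φ i.castSucc) :
    φ 0 * chainSum α γ = ∑ i, φ i * ∏ k ∈ Finset.univ.erase i, α k := by
  have hprod : ∀ {m : ℕ} (α : Fin m → R) (i : Fin m),
      ∏ k ∈ Finset.univ.erase i, α k = ∏ k, if k = i then 1 else α k := by
    intro m α i
    rw [← Finset.mul_prod_erase Finset.univ _ (Finset.mem_univ i), if_pos rfl, one_mul]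
    exact Finset.prod_congr rfl fun k hk => (if_neg (Finset.ne_of_mem_erase hk)).symm
  simp only [hprod]
  induction m with
  | zero => simp [chainSum]
  | succ m ih =>
    have h1 := ih (fun k => α k.succ) (fun k => γ k.succ) (fun k => ρ k.succ) (fun k => φ k.succ)
      (fun i => hγ _) (fun i => hφ i.succ)
    have h2 := hφ 0
    simp only [Fin.castSucc_zero] at h2
    rw [chainSum_succ, hγ 0, Fin.sum_univ_succ]
    simp only [Fin.prod_univ_succ (n := m + 1), Fin.succ_inj, if_true, one_mul, Fin.succ_ne_zero,
      if_false, (Fin.succ_ne_zero _).symm]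
    rw [mul_add]
    congr 1
    calc φ 0 * (ρ 0 * α 0 * chainSum (fun k => α k.succ) fun k => γ k.succ)
        = α 0 * (φ (Fin.succ 0) * chainSum (fun k => α k.succ) fun k => γ k.succ) := by
          rw [h2]; ring
      _ = _ := by
          rw [h1, Finset.mul_sum]
          exact Finset.sum_congr rfl fun i _ => by ring

theorem sum_mul_prod_erase {K ι : Type*} [Field K] [Fintype ι] [DecidableEq ι] (α φ : ι → K)
    (j : ι) (hα : ∀ i, i ≠ j → α i ≠ 0) :
    ∑ i, φ i * ∏ k ∈ Finset.univ.erase i, α k = (∏ k ∈ Finset.univ.erase j, α k) *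
      (φ j + α j * ∑ i ∈ Finset.univ.erase j, φ i / α i) := by
  rw [← Finset.add_sum_erase _ _ (Finset.mem_univ j), mul_add, mul_comm (φ j), ← mul_assoc,
    Finset.mul_sum]
  congr 1
  refine Finset.sum_congr rfl fun i hi => ?_
  have h1 := Finset.mul_prod_erase Finset.univ α (Finset.mem_univ i)
  have h2 := Finset.mul_prod_erase Finset.univ α (Finset.mem_univ j)
  have h3 := hα i (Finset.ne_of_mem_erase hi)
  field_simp
  linear_combination φ i * (h1 - h2)

theorem prod_add_mul_eq_sum_sigma {K : Type*} [Field K] {n : ℕ} (q : Fin n → ℤ) (a b : K) :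
    ∏ i, (b * q i + a) = ∑ k ∈ Finset.range (n + 1), b ^ k * a ^ (n - k) * (sigma k q : K) := by
  rw [Finset.prod_add, Finset.sum_powerset, Finset.card_univ, Fintype.card_fin]
  refine Finset.sum_congr rfl fun k _ => ?_
  rw [sigma, Int.cast_sum, Finset.mul_sum]
  refine Finset.sum_congr rfl fun s hs => ?_
  obtain ⟨-, hs⟩ := Finset.mem_powersetCard.1 hs
  rw [Finset.prod_mul_distrib, Finset.prod_const, Finset.prod_const, hs,
    Finset.card_sdiff_of_subset (Finset.subset_univ s), hs, Finset.card_univ, Fintype.card_fin,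
    Int.cast_prod]
  ring

theorem sum_range_add_neg_one_pow {R : Type*} [CommRing R] (g : ℕ → R) (m : ℕ) :
    ∑ k ∈ Finset.range (2 * m + 2), (g k + (-1) ^ k * g k)
      = 2 * ∑ k ∈ Finset.range (m + 1), g (2 * k) := by
  induction m with
  | zero => simp [Finset.sum_range_succ]; ring
  | succ m ih =>
    rw [show 2 * (m + 1) + 2 = 2 * m + 2 + 1 + 1 from rfl, Finset.sum_range_succ,
      Finset.sum_range_succ, ih, Finset.sum_range_succ _ (m + 1)]
    have h : Even (2 * m + 2) := ⟨m + 1, by ring⟩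
    have h' : Odd (2 * m + 2 + 1) := h.add_one
    rw [h.neg_one_pow, h'.neg_one_pow, show 2 * (m + 1) = 2 * m + 2 from rfl]
    ring

end ChainSum

section Evaluation

variable {K : Type*} [Field K] {t : K} {m : ℕ} {q : Fin (m + 1) → ℤ} {u : PretzelEdge q → Bool}

theorem exists_chainSum_of_odd [CharZero K] (ht : t ≠ 0) (ht1 : 1 + t ≠ 0) (hm : Odd (m + 1))
    (hq : ∀ i, Odd (q i)) (hu : IsCoherent u) :
    ∃ η, IsSignedPow t η ∧ chainSum (bottomLeft t u) (bottomRight t u) =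
      η * (1 / 2 ^ (m + 1 - 1) * ∑ k ∈ Finset.range ((m + 1 - 1) / 2 + 1),
          (t - 1) ^ (2 * k) * (t + 1) ^ (m + 1 - 1 - 2 * k) * (sigma (2 * k) q : K)) := by
  obtain ⟨p, hp⟩ : ∃ p, m = 2 * p := by
    obtain ⟨p, hp⟩ := hm
    exact ⟨p, by omega⟩
  set w := signPow t (u ⟨0, 0, true⟩) with hw
  have hne := hu.ne_of_odd hm hq
  have hwi : ∀ i, signPow t (u ⟨i, 0, true⟩) = w := fun i => by
    rw [hu.eq_zero_of_odd hm hq i]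
  have hw1 : 1 + w ≠ 0 := by
    rw [hw]
    cases u ⟨0, 0, true⟩
    · intro h
      have h' : 1 + t⁻¹ = 0 := h
      apply ht1
      have : 1 + t = t * (1 + t⁻¹) := by
        field_simp
        ring
      rw [this, h', mul_zero]
    · exact ht1
  have hα : ∀ i, bottomLeft t u i = 2⁻¹ * ((1 - w) * q i + (1 + w)) := by
    intro i
    have := two_mul_bottomLeft_of_ne ht (hne i)
    rw [if_pos (hq i), hwi] at this
    linear_combination 2⁻¹ * this
  have hγ : ∀ i, bottomRight t u i = (- 2⁻¹) * ((w - 1) * q i + (1 + w)) := by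
    intro i
    have := bottomLeft_sub_bottomRight_of_ne_of_odd ht (hne i) (hq i)
    rw [hwi] at this
    linear_combination hα i - this
  have hchain := mul_chainSum_of_sub_eq (bottomLeft t u) (bottomRight t u) (1 + w) fun i => by
    rw [bottomLeft_sub_bottomRight_of_ne_of_odd ht (hne i) (hq i), hwi]
  have hsum : (1 + w) * chainSum (bottomLeft t u) (bottomRight t u) = (1 + w) *
      (1 / 2 ^ m * ∑ k ∈ Finset.range (p + 1),
          (w - 1) ^ (2 * k) * (w + 1) ^ (m - 2 * k) * (sigma (2 * k) q : K)) := by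
    rw [hchain]
    simp only [hα, hγ, Finset.prod_mul_distrib, Finset.prod_const, Finset.card_univ,
      Fintype.card_fin]
    rw [hm.neg_pow, prod_add_mul_eq_sum_sigma, prod_add_mul_eq_sum_sigma, neg_mul, sub_neg_eq_add,
      ← mul_add, ← Finset.sum_add_distrib]
    have h1 : ∀ k ∈ Finset.range (m + 1 + 1),
        (1 - w) ^ k * (1 + w) ^ (m + 1 - k) * (sigma k q : K) +
          (w - 1) ^ k * (1 + w) ^ (m + 1 - k) * (sigma k q : K) =
        (w - 1) ^ k * (1 + w) ^ (m + 1 - k) * (sigma k q : K) +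
          (-1) ^ k * ((w - 1) ^ k * (1 + w) ^ (m + 1 - k) * (sigma k q : K)) := by
      intro k _
      rw [show 1 - w = (-1) * (w - 1) by ring, mul_pow]
      ring
    rw [Finset.sum_congr rfl h1, show m + 1 + 1 = 2 * p + 2 by omega, sum_range_add_neg_one_pow,
      pow_succ, Finset.mul_sum, Finset.mul_sum, Finset.mul_sum, Finset.mul_sum]
    refine Finset.sum_congr rfl fun k hk => ?_
    have hk' : k ≤ p := Nat.lt_succ_iff.1 (Finset.mem_range.1 hk)
    rw [show m + 1 - 2 * k = m - 2 * k + 1 by omega, inv_pow]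
    field_simp
    ring
  have hval := mul_left_cancel₀ hw1 hsum
  have hp2 : (m + 1 - 1) / 2 = p := by omega
  rw [hp2, Nat.add_sub_cancel]
  cases hu0 : u ⟨0, 0, true⟩
  · refine ⟨t ^ (-m : ℤ), IsSignedPow.zpow _, ?_⟩
    have hw' : w = t⁻¹ := by rw [hw, hu0]; rfl
    rw [hval, Finset.mul_sum, Finset.mul_sum, Finset.mul_sum]
    refine Finset.sum_congr rfl fun k hk => ?_
    have hk' : k ≤ p := Nat.lt_succ_iff.1 (Finset.mem_range.1 hk)
    have h1 : (w - 1) ^ (2 * k) = (t⁻¹) ^ (2 * k) * (t - 1) ^ (2 * k) := by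
      rw [← mul_pow, hw', ← (even_two_mul k).neg_pow]
      congr 1
      field_simp
      ring
    have h2 : (w + 1) ^ (m - 2 * k) = (t⁻¹) ^ (m - 2 * k) * (t + 1) ^ (m - 2 * k) := by
      rw [← mul_pow, hw']
      congr 1
      field_simp
      ring
    have h3 : (t⁻¹) ^ (2 * k) * (t⁻¹) ^ (m - 2 * k) = t ^ (-m : ℤ) := by
      rw [← pow_add, show 2 * k + (m - 2 * k) = m by omega, zpow_neg, zpow_natCast, inv_pow]
    rw [h1, h2, ← h3]
    ring
  · refine ⟨1, IsSignedPow.one, ?_⟩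
    have hw' : w = t := by rw [hw, hu0]; rfl
    rw [hval, hw', one_mul]

/-- The chain sum if `q j` is the only even number. Both possibilities for the directions of the
strands in the twist region `j` are still covered, hence `bottomLeft t u j` is left as it is. -/
theorem exists_chainSum_of_even (ht : t ≠ 0) (htk : ∀ k : ℤ, 1 + t ^ k ≠ 0) {j : Fin (m + 1)}
    (hj : Even (q j)) (hq : ∀ i, i ≠ j → Odd (q i)) (hu : IsCoherent u) :
    ∃ η, IsSignedPow t η ∧ chainSum (bottomLeft t u) (bottomRight t u) =
      η * ((∏ i ∈ Finset.univ.erase j, (1 + t ^ q i) / (1 + t)) *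
        ((if u ⟨j, 0, false⟩ then 1 else -t) + bottomLeft t u j * (1 + t) *
          ((∑ i ∈ Finset.univ.erase j, (u ⟨i, 0, true⟩).toNat : ℕ) -
            ∑ i ∈ Finset.univ.erase j, t ^ q i / (1 + t ^ q i)))) := by
  have ht1 : 1 + t ≠ 0 := by simpa using htk 1
  have hw1 : ∀ i, 1 + signPow t (u ⟨i, 0, true⟩) ≠ 0 := by
    intro i
    cases u ⟨i, 0, true⟩
    · simpa [signPow] using htk (-1)
    · exact ht1
  have hpar := hu.eq_of_ne hj hq
  have hα : ∀ i, i ≠ j → bottomLeft t u i = (if u ⟨i, 0, true⟩ then 1 else t ^ (1 - q i)) *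
      ((1 + t ^ q i) / (1 + t)) := by
    intro i hi
    have h := bottomLeft_of_eq ht (hpar i hi)
    rw [(hq i hi).neg_zpow] at h
    refine mul_right_cancel₀ (hw1 i) (h.trans ?_)
    cases u ⟨i, 0, true⟩
    · simp only [signPow, Bool.false_eq_true, if_false, inv_zpow', zpow_neg, zpow_sub₀ ht, zpow_one]
      have := zpow_ne_zero (q i) ht
      field_simp
      ring
    · simp only [signPow, if_true]
      field_simp
      ring
  have hα0 : ∀ i, i ≠ j → bottomLeft t u i ≠ 0 := by
    intro i hi
    rw [hα i hi]
    refine mul_ne_zero ?_ (div_ne_zero (htk _) ht1)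
    split_ifs
    exacts [one_ne_zero, zpow_ne_zero _ ht]
  -- `φ` depends on the direction of the left strand; `ρ` is its change across a twist region
  let φ : Fin (m + 1) → K := fun i => if u ⟨i, 0, false⟩ then 1 else -t
  let ρ : Fin (m + 1) → K := fun i => if u ⟨i, 0, false⟩ = u ⟨i, 0, true⟩
    then - signPow t (u ⟨i, 0, true⟩) else 1
  have hγ : ∀ i, bottomRight t u i = ρ i * bottomLeft t u i := by
    intro i
    by_cases h : u ⟨i, 0, false⟩ = u ⟨i, 0, true⟩
    · rw [bottomRight_of_eq ht h (hw1 i)]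
      simp only [ρ, if_pos h]
    · have hij : i = j := by
        by_contra hij
        exact h (hpar i hij)
      subst hij
      rw [bottomRight_of_ne_of_even ht (Bool.eq_not_of_ne h) hj]
      simp only [ρ, if_neg h, one_mul]
  have hφ : ∀ i : Fin m, φ i.succ = ρ i.castSucc * φ i.castSucc := by
    intro i
    have h := hu.top i.castSucc
    have hr : finRotate (m + 1) i.castSucc = i.succ := by ext; simp
    rw [hr] at h
    simp only [φ, ρ, h, signPow]
    cases u ⟨i.castSucc, 0, true⟩ <;> cases u ⟨i.castSucc, 0, false⟩ <;> simp [ht]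
  have hφ0 : IsSignedPow t (φ 0) := by
    simp only [φ]
    split_ifs
    exacts [IsSignedPow.one, IsSignedPow.self.neg]
  have hsum := mul_chainSum_of_eq_mul _ _ ρ φ hγ hφ
  rw [sum_mul_prod_erase _ _ j hα0,
    Finset.prod_congr rfl fun i hi => hα i (Finset.ne_of_mem_erase hi),
    Finset.prod_mul_distrib] at hsum
  have hterm : ∀ i ∈ Finset.univ.erase j, φ i / bottomLeft t u i =
      (1 + t) * ((u ⟨i, 0, true⟩).toNat - t ^ q i / (1 + t ^ q i)) := by
    intro i hi
    have hi := Finset.ne_of_mem_erase hi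
    have h1 := htk (q i)
    have h2 := zpow_ne_zero (q i) ht
    rw [hα i hi]
    simp only [φ, hpar i hi]
    cases u ⟨i, 0, true⟩
    · simp only [zpow_sub₀ ht, zpow_one, Bool.false_eq_true, if_false, Bool.toNat_false,
        Nat.cast_zero]
      field_simp
      ring
    · simp only [if_true, Bool.toNat_true, Nat.cast_one]
      field_simp
      ring
  rw [Finset.sum_congr rfl hterm, ← Finset.mul_sum, Finset.sum_sub_distrib, ← Nat.cast_sum] at hsum
  have hη : IsSignedPow t
      (∏ i ∈ Finset.univ.erase j, if u ⟨i, 0, true⟩ then 1 else t ^ (1 - q i)) := by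
    refine IsSignedPow.prod ht _ fun i _ => ?_
    split_ifs
    exacts [IsSignedPow.one, IsSignedPow.zpow _]
  refine ⟨_, hη.div ht hφ0, ?_⟩
  have h0 := hφ0.ne_zero ht
  refine mul_left_cancel₀ h0 (hsum.trans ?_)
  simp only [φ] at h0 ⊢
  field_simp

end Evaluation

/-! ### The Alexander polynomial -/

theorem laurentToRatFunc_T_one : laurentToRatFunc (LaurentPolynomial.T 1) = RatFunc.X := by
  simp [laurentToRatFunc]

theorem one_add_X_pow_ne_zero (k : ℕ) : (1 : RatFunc ℚ) + RatFunc.X ^ k ≠ 0 := by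
  rw [← RatFunc.algebraMap_X, ← map_pow, ← map_one (algebraMap (Polynomial ℚ) (RatFunc ℚ)),
    ← map_add]
  refine (map_ne_zero_iff _ (RatFunc.algebraMap_injective ℚ)).2 fun h => ?_
  have := congrArg (Polynomial.eval 1) h
  norm_num at this

theorem one_add_X_zpow_ne_zero (k : ℤ) : (1 : RatFunc ℚ) + RatFunc.X ^ k ≠ 0 := by
  obtain ⟨k, rfl | rfl⟩ := k.eq_nat_or_neg
  · exact one_add_X_pow_ne_zero k
  · rw [zpow_neg, zpow_natCast]
    intro h
    have h0 : (RatFunc.X : RatFunc ℚ) ^ k ≠ 0 := pow_ne_zero _ RatFunc.X_ne_zero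
    apply one_add_X_pow_ne_zero k
    field_simp at h
    linear_combination h

/-- It suffices to evaluate the chain sum, for all directions of the edges that may occur. -/
theorem alexanderPolynomialEq_of_chainSum {m : ℕ} {q : Fin (m + 1) → ℤ} {g : RatFunc ℚ}
    (ho : Nonempty (pretzel q).Orientation)
    (h : ∀ u : PretzelEdge q → Bool, IsCoherent u → ∃ η, IsSignedPow RatFunc.X η ∧
      chainSum (bottomLeft RatFunc.X u) (bottomRight RatFunc.X u) = η * g) :
    (pretzel q).AlexanderPolynomialEq g := by
  refine ⟨exists_isAlexanderPolynomial ho, fun Δ hΔ => ?_⟩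
  obtain ⟨o, η, hη, h1⟩ := exists_minor_eq_chainSum laurentToRatFunc hΔ
  rw [laurentToRatFunc_T_one] at hη h1
  obtain ⟨η', hη', h2⟩ := h _ (isCoherent_pretzelUp o)
  obtain ⟨k, hk⟩ := hη.mul RatFunc.X_ne_zero hη'
  refine ⟨k, ?_⟩
  rw [h1, h2, ← mul_assoc]
  rcases hk with hk | hk
  · exact Or.inl (by rw [hk])
  · exact Or.inr (by rw [hk, neg_mul])

theorem theorem1 {n : ℕ} (q : Fin n → ℤ) :
    (∀ j, Odd n → Even (q j) → (∀ i, i ≠ j → Odd (q i)) →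
      (pretzel q).AlexanderPolynomialEq
        ((∏ i ∈ Finset.univ.erase j, (1 + RatFunc.X ^ q i) / (1 + RatFunc.X)) *
          (1 + (q j : RatFunc ℚ) / 2 * (RatFunc.X⁻¹ - RatFunc.X) *
            ((∑ i ∈ Finset.univ.erase j, RatFunc.X ^ q i / (1 + RatFunc.X ^ q i))
              - ((n : RatFunc ℚ) - 1) / 2)))) ∧
    (∀ j, Even n → Even (q j) → (∀ i, i ≠ j → Odd (q i)) →
      (pretzel q).AlexanderPolynomialEq
        ((∏ i ∈ Finset.univ.erase j, (1 + RatFunc.X ^ q i) / (1 + RatFunc.X)) *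
          (RatFunc.X ^ (q j / 2) + (RatFunc.X ^ (q j / 2) - RatFunc.X ^ (-(q j / 2))) *
            ((∑ i ∈ Finset.univ.erase j, RatFunc.X ^ q i / (1 + RatFunc.X ^ q i))
              - (n : RatFunc ℚ) / 2)))) ∧
    (Odd n → (∀ i, Odd (q i)) →
      (pretzel q).AlexanderPolynomialEq
        (1 / 2 ^ (n - 1) * ∑ k ∈ Finset.range ((n - 1) / 2 + 1),
          (RatFunc.X - 1) ^ (2 * k) * (RatFunc.X + 1) ^ (n - 1 - 2 * k) *
            (sigma (2 * k) q : RatFunc ℚ))) := by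
  have hX : (RatFunc.X : RatFunc ℚ) ≠ 0 := RatFunc.X_ne_zero
  have hX1 : (1 : RatFunc ℚ) + RatFunc.X ≠ 0 := by simpa using one_add_X_pow_ne_zero 1
  rcases n with _ | m
  · exact ⟨fun j => j.elim0, fun j => j.elim0, fun h => absurd h (by decide)⟩
  refine ⟨fun j hn hj hq => ?_, fun j hn hj hq => ?_, fun hn hq => ?_⟩
  · refine alexanderPolynomialEq_of_chainSum (nonempty_orientation_of_even hj hq) fun u hu => ?_
    obtain ⟨η, hη, h⟩ := exists_chainSum_of_even hX one_add_X_zpow_ne_zero hj hq hu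
    have hcount := hu.sum_erase hj hq
    generalize ∑ i ∈ Finset.univ.erase j, (u ⟨i, 0, true⟩).toNat = S at h hcount
    generalize ∑ i ∈ Finset.univ.erase j,
      (RatFunc.X : RatFunc ℚ) ^ q i / (1 + RatFunc.X ^ q i) = Z at h ⊢
    have hne : u ⟨j, 0, false⟩ = !u ⟨j, 0, true⟩ := by
      refine Bool.eq_not_of_ne fun he => ?_
      rw [← hcount, he] at hn
      exact Nat.not_odd_iff_even.2 ⟨S + (u ⟨j, 0, true⟩).toNat, by ring⟩ hn
    have hα := two_mul_bottomLeft_of_ne hX hne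
    rw [if_neg (Int.not_odd_iff_even.2 hj), add_zero] at hα
    have hα' : bottomLeft RatFunc.X u j =
        (q j : RatFunc ℚ) / 2 * (1 - signPow RatFunc.X (u ⟨j, 0, true⟩)) := by
      linear_combination 2⁻¹ * hα
    have hS : ((m + 1 : ℕ) : RatFunc ℚ) = 2 * S + 1 := by
      rw [← hcount, hne]
      cases u ⟨j, 0, true⟩ <;> simp
    rw [hS]
    rw [hα', hne] at h
    cases hu0 : u ⟨j, 0, true⟩
    · refine ⟨η, hη, h.trans ?_⟩
      simp only [hu0, signPow, Bool.not_false, if_true, Bool.false_eq_true, if_false]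
      field_simp
      ring
    · refine ⟨η * -RatFunc.X, hη.mul hX IsSignedPow.self.neg, h.trans ?_⟩
      simp only [hu0, signPow, Bool.not_true, if_true, Bool.false_eq_true, if_false]
      field_simp
      ring
  · refine alexanderPolynomialEq_of_chainSum (nonempty_orientation_of_even hj hq) fun u hu => ?_
    obtain ⟨η, hη, h⟩ := exists_chainSum_of_even hX one_add_X_zpow_ne_zero hj hq hu
    have hcount := hu.sum_erase hj hq
    generalize ∑ i ∈ Finset.univ.erase j, (u ⟨i, 0, true⟩).toNat = S at h hcount
    generalize ∑ i ∈ Finset.univ.erase j,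
      (RatFunc.X : RatFunc ℚ) ^ q i / (1 + RatFunc.X ^ q i) = Z at h ⊢
    have heq : u ⟨j, 0, false⟩ = u ⟨j, 0, true⟩ := by
      by_contra he
      rw [← hcount, Bool.eq_not_of_ne he] at hn
      cases hu0 : u ⟨j, 0, true⟩ <;> simp [hu0] at hn
    have hα := bottomLeft_of_eq hX heq
    rw [hj.neg_zpow] at hα
    obtain ⟨p, hp⟩ := hj
    have hp2 : q j / 2 = p := by omega
    rw [hp2, zpow_neg]
    have hpow := (congrArg (fun k : ℤ => signPow RatFunc.X (u ⟨j, 0, true⟩) ^ k) hp).trans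
      (zpow_add₀ (signPow_ne_zero hX _) p p)
    rw [hpow] at hα
    have hS : ((m + 1 : ℕ) : RatFunc ℚ) = 2 * (S + (u ⟨j, 0, true⟩).toNat : ℕ) := by
      have hS' : m + 1 = 2 * (S + (u ⟨j, 0, true⟩).toNat) := by
        rw [heq] at hcount
        omega
      exact_mod_cast congrArg (Nat.cast : ℕ → RatFunc ℚ) hS'
    rw [hS]
    have hXp : (RatFunc.X : RatFunc ℚ) ^ p ≠ 0 := zpow_ne_zero _ hX
    rw [heq] at h
    cases hu0 : u ⟨j, 0, true⟩
    · refine ⟨η * (-RatFunc.X * (RatFunc.X ^ p)⁻¹),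
        hη.mul hX (IsSignedPow.self.neg.mul hX (IsSignedPow.zpow p).inv), h.trans ?_⟩
      simp only [hu0, signPow, inv_zpow', zpow_neg, Bool.toNat_false, add_zero, Bool.false_eq_true,
        if_false] at hα ⊢
      have hα' : bottomLeft (RatFunc.X : RatFunc ℚ) u j * (1 + RatFunc.X) =
          RatFunc.X * (1 - (RatFunc.X ^ p)⁻¹ * (RatFunc.X ^ p)⁻¹) := by
        rw [← hα]
        field_simp
        ring
      rw [hα']
      field_simp
      ring
    · refine ⟨η * RatFunc.X ^ p, hη.mul hX (IsSignedPow.zpow p), h.trans ?_⟩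
      simp only [hu0, signPow, if_true, Bool.toNat_true] at hα ⊢
      rw [hα]
      push_cast
      field_simp
      ring
  · exact alexanderPolynomialEq_of_chainSum (nonempty_orientation_of_odd hq) fun u hu =>
      exists_chainSum_of_odd hX hX1 hn hq hu
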